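/- Let $m\ge 3$ be odd. All superalgebras are over $\mathbb C$, and isomorphisms preserve the $\mathbb Z_2$-grading. A Leibniz superalgebra is a $\mathbb Z_2$-graded space $L=L_0\oplus L_1$ with a bilinear product satisfying $[L_\alpha,L_\beta]\subseteq L_{\alpha+\beta}$ and $[u,[v,w]]=[[u,v],w]-(-1)^{\alpha\beta}[[u,w],v]$ for $u\in L$, $v\in L_\alpha$, $w\in L_\beta$. The nilradical of $L$ is the maximal nilpotent (graded, two-sided) ideal containing $[L,L]$. Let $N_{2,m}$ be the Lie superalgebra with even basis $e_1,e_2$, odd basis $y_1,\dots,y_m$ and nonzero products $$[y_i,e_1]=-[e_1,y_i]=y_{i+1}\ (1\le i\le m-1),\qquad [y_{m+1-i},y_i]=(-1)^{i+1}e_2\ (1\le i\le m).$$ For a linear map $D$ of $N_{2,m}$ and $w\in N_{2,m}$ let $N_{2,m}(D,w)$ be the superalgebra $N_{2,m}\oplus\mathbb Cx$, $x$ even, whose product extends that of $N_{2,m}$ by $[n,x]=-[x,n]=D(n)$ for $n\in N_{2,m}$ and $[x,x]=w$. Put: - $M_1=N_{2,m}(D,e_2)$ with $D(e_1)=e_1$,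 $D(e_2)=0$, $D(y_i)=\left(i-\frac{m+1}{2}\right)y_i$; - $M_2(\alpha)=N_{2,m}(D,0)$, $\alpha\in\mathbb C$, with $D(e_1)=e_1$, $D(e_2)=\alpha e_2$, $D(y_i)=\left(i+\frac{\alpha-m-1}{2}\right)y_i$; - $M_3=N_{2,m}(D,0)$ with $D(e_1)=e_1+e_2$, $D(e_2)=e_2$, $D(y_i)=\left(i-\frac m2\right)y_i$; - $M_4(b_2,b_4,\dots,b_{m-1})=N_{2,m}(D,0)$, $b_{2k}\in\mathbb C$, with $D(e_1)=0$, $D(e_2)=2e_2$, $D(y_i)=y_i+\sum_{k=1}^{\lfloor (m-i+1)/2\rfloor}b_{2k}\,y_{i+2k-1}$. Theorem. Every $(m+3)$-dimensional solvable Leibniz superalgebra whose nilradical is isomorphic to $N_{2,m}$ is isomorphic to one of $M_1$, $M_2(\alpha)$, $M_3$, $M_4(b_2,b_4,\dots,b_{m-1})$, and each of these is such a superalgebra. Superalgebras from different ones of these four families are never isomorphic. Moreover $M_2(\alpha)\cong M_2(\beta)$ only if $\alpha=\beta$, and $M_4(b_2,b_4,\dots,b_{m-1})\cong M_4(b_2',b_4',\dots,b_{m-1}')$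 if and only if there is $r\in\mathbb C\setminus\{0\}$ with $b_{2k}'=r^{2k-1}b_{2k}$ for all $2\le k\le\frac{m-1}{2}$ (the parameter $b_2$ being arbitrary). In particular, the first nonzero parameter of $M_4(b_2,b_4,\dots,b_{m-1})$ can be reduced to $1$: if $b_{2j}=0$ for all $j<k$ and $b_{2k}\ne0$, then $M_4(b_2,\dots,b_{m-1})\cong M_4(b_2',\dots,b_{m-1}')$ for some parameters with $b_{2j}'=0$ for all $j<k$ and $b_{2k}'=1$. -/

import Mathlib

noncomputable section

/-- A complex superalgebra on the vector space `A`: a decomposition of `A` as the direct sum of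
an even part `part 0` and an odd part `part 1`, and a bilinear product compatible with it. -/
structure Superalgebra (A : Type*) [AddCommGroup A] [Module ℂ A] where
  part : ZMod 2 → Submodule ℂ A
  isCompl : IsCompl (part 0) (part 1)
  mul : A →ₗ[ℂ] A →ₗ[ℂ] A
  mul_mem : ∀ (a b : ZMod 2) (v w : A), v ∈ part a → w ∈ part b → mul v w ∈ part (a + b)

namespace Superalgebra

variable {A : Type*} [AddCommGroup A] [Module ℂ A] {B : Type*} [AddCommGroup B] [Module ℂ B]

/-- The Leibniz superidentity
`[u, [v, w]] = [[u, v], w] - (-1) ^ (a b) [[u, w], v]` for `v`, `w` of degrees `a`, `b`. -/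
def IsLeibniz (S : Superalgebra A) : Prop :=
  ∀ (a b : ZMod 2) (u v w : A), v ∈ S.part a → w ∈ S.part b →
    S.mul u (S.mul v w) =
      S.mul (S.mul u v) w - (-1 : ℂ) ^ (a.val * b.val) • S.mul (S.mul u w) v

/-- The derived series `L`, `[L, L]`, `[[L, L], [L, L]]`, ... -/
def derivedSeries (S : Superalgebra A) : ℕ → Submodule ℂ A
  | 0 => ⊤
  | n + 1 => Submodule.map₂ S.mul (derivedSeries S n) (derivedSeries S n)

def IsSolvable (S : Superalgebra A) : Prop :=
  ∃ n : ℕ, S.derivedSeries n = ⊥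

/-- Two-sided ideals that are graded, that is, spanned by their even and odd elements. -/
structure IsIdeal (S : Superalgebra A) (I : Submodule ℂ A) : Prop where
  graded : I ≤ (I ⊓ S.part 0) ⊔ (I ⊓ S.part 1)
  mul_right : ∀ v ∈ I, ∀ w : A, S.mul v w ∈ I
  mul_left : ∀ v ∈ I, ∀ w : A, S.mul w v ∈ I

/-- The lower central series `I`, `[I, I]`, `[[I, I], I]`, ... of a subspace `I`. -/
def lowerCentralSeries (S : Superalgebra A) (I : Submodule ℂ A) : ℕ → Submodule ℂ A
  | 0 => I
  | n + 1 => Submodule.map₂ S.mul (lowerCentralSeries S I n) I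

/-- `I` is nilpotent as an algebra in its own right. -/
def IsNilpotentSub (S : Superalgebra A) (I : Submodule ℂ A) : Prop :=
  ∃ n : ℕ, S.lowerCentralSeries I n = ⊥

/-- `N` is a nilradical: maximal among the nilpotent ideals that contain `[L, L]`. -/
def IsNilradical (S : Superalgebra A) (N : Submodule ℂ A) : Prop :=
  Maximal (fun I : Submodule ℂ A =>
    S.IsIdeal I ∧ S.IsNilpotentSub I ∧ Submodule.map₂ S.mul ⊤ ⊤ ≤ I) N

/-- Isomorphism of superalgebras: a linear bijection that preserves degrees and products. -/
def Iso (S : Superalgebra A) (T : Superalgebra B) : Prop :=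
  ∃ f : A ≃ₗ[ℂ] B, (∀ (a : ZMod 2), ∀ v ∈ S.part a, f v ∈ T.part a) ∧
    ∀ v w : A, f (S.mul v w) = T.mul (f v) (f w)

/-- The superalgebra `T` is isomorphic to the graded ideal `N` of `S`, where `N` carries the
grading and the product inherited from `S`. -/
def IsoIdeal (T : Superalgebra B) (S : Superalgebra A) (N : Submodule ℂ A) : Prop :=
  ∃ f : B ≃ₗ[ℂ] N, (∀ (a : ZMod 2), ∀ v ∈ T.part a, (f v : A) ∈ S.part a) ∧
    ∀ v w : B, (f (T.mul v w) : A) = S.mul (f v : A) (f w : A)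

/-- The superalgebra with basis `ι`, where the basis element `i` has degree `deg i` and the
product of the basis elements `i` and `j` is `∑ k, c i j k • k`. -/
def ofTable {ι : Type*} [Fintype ι] (deg : ι → ZMod 2) (c : ι → ι → ι → ℂ)
    (hc : ∀ i j k, c i j k ≠ 0 → deg k = deg i + deg j) : Superalgebra (ι → ℂ) where
  part a :=
    { carrier := {v | ∀ i, deg i ≠ a → v i = 0}
      add_mem' := fun {v w} hv hw i hi => by simp [hv i hi, hw i hi]
      zero_mem' := fun i _ => rfl
      smul_mem' := fun r v hv i hi => by simp [hv i hi] }
  isCompl := by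
    refine ⟨Submodule.disjoint_def.2 fun v h0 h1 => funext fun i => ?_,
      codisjoint_iff.2 (eq_top_iff.2 fun v _ => Submodule.mem_sup.2
        ⟨fun i => if deg i = 0 then v i else 0, fun i hi => if_neg hi,
          fun i => if deg i = 0 then 0 else v i, fun i hi => ?_, ?_⟩)⟩
    · by_cases h : deg i = 0
      · exact h1 i (by rw [h]; decide)
      · exact h0 i h
    · have : deg i = 0 := by
        generalize deg i = d at hi
        revert hi; revert d; decide
      simp [this]
    · funext i
      by_cases h : deg i = 0 <;> simp [h]
  mul := LinearMap.mk₂ ℂ (fun v w => fun k => ∑ i, ∑ j, v i * w j * c i j k)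
    (fun v v' w => by funext k; simp [add_mul, Finset.sum_add_distrib])
    (fun r v w => by funext k; simp [Finset.mul_sum, mul_assoc])
    (fun v w w' => by funext k; simp [mul_add, add_mul, Finset.sum_add_distrib])
    (fun r v w => by funext k; simp [Finset.mul_sum, mul_assoc, mul_left_comm])
  mul_mem a b v w hv hw k hk := by
    change ∑ i, ∑ j, v i * w j * c i j k = 0
    refine Finset.sum_eq_zero fun i _ => Finset.sum_eq_zero fun j _ => ?_
    by_cases hi : deg i = a
    · by_cases hj : deg j = b
      · have : c i j k = 0 := by
          by_contra h
          exact hk (by rw [hc i j k h, hi, hj])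
        simp [this]
      · simp [hw j hj]
    · simp [hv i hi]

end Superalgebra

/-- The basis of `N_{2,m}`: `e₁`, `e₂` are even; `y i`, for `i = 0, ..., m - 1`, is odd and
stands for the basis element usually written `y_{i+1}`. -/
inductive NIdx (m : ℕ) : Type
  | e₁ : NIdx m
  | e₂ : NIdx m
  | y (i : Fin m) : NIdx m
  deriving DecidableEq, Fintype

namespace NIdx

variable {m : ℕ}

def deg : NIdx m → ZMod 2
  | e₁ => 0
  | e₂ => 0
  | y _ => 1

/-- The vector `y_{k+1}`, read as `0` when `k + 1 > m`. -/
def yVec (m k : ℕ) : NIdx m → ℂ :=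
  if h : k < m then Pi.single (y ⟨k, h⟩) 1 else 0

/-- Structure constants of `N_{2,m}`, with `y_i` written `y (i - 1)`:
`[y_i, e₁] = -[e₁, y_i] = y_{i+1}` and `[y_i, y_j] = (-1)^(j+1) e₂` for `i + j = m + 1`. -/
def nTable (m : ℕ) : NIdx m → NIdx m → NIdx m → ℂ
  | y i, e₁ => yVec m (i + 1)
  | e₁, y i => -yVec m (i + 1)
  | y i, y j => if (i : ℕ) + j + 1 = m then Pi.single e₂ ((-1) ^ (j : ℕ)) else 0
  | _, _ => 0

theorem deg_of_single {a k : NIdx m} {r : ℂ} (h : (Pi.single a r : NIdx m → ℂ) k ≠ 0) :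
    k.deg = a.deg := by
  by_cases hk : k = a
  · rw [hk]
  · exact absurd (by rw [Pi.single_apply, if_neg hk]) h

theorem deg_of_yVec {n : ℕ} {k : NIdx m} (h : yVec m n k ≠ 0) : k.deg = 1 := by
  unfold yVec at h
  split_ifs at h with hn
  · exact deg_of_single h
  · exact absurd rfl h

theorem deg_nTable (i j k : NIdx m) (h : nTable m i j k ≠ 0) : k.deg = i.deg + j.deg := by
  cases i <;> cases j <;> simp only [nTable] at h
  case y.e₁ i => simpa [deg] using deg_of_yVec h
  case e₁.y i => simpa [deg] using deg_of_yVec (neg_ne_zero.1 h)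
  case y.y i j =>
    split_ifs at h with hij
    · rw [deg_of_single h]; simp only [deg]; decide
    · exact absurd rfl h
  all_goals exact absurd rfl h

end NIdx

open NIdx in
/-- The nilpotent Lie superalgebra `N_{2,m}` (`m` odd). -/
def superN (m : ℕ) : Superalgebra (NIdx m → ℂ) :=
  Superalgebra.ofTable deg (nTable m) deg_nTable

/-- The degree on the basis of `N_{2,m}` enlarged by one even element `x`, written `none`. -/
def extDeg {m : ℕ} (o : Option (NIdx m)) : ZMod 2 := o.elim 0 NIdx.deg

/-- A vector in the span of the basis of `N_{2,m}`, seen in the enlarged space. -/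
def extVec {m : ℕ} (v : NIdx m → ℂ) (o : Option (NIdx m)) : ℂ := o.elim 0 v

/-- Multiplication table of the algebra spanned by `N_{2,m}` and `x`, in which
`[n, x] = -[x, n] = D n` for basis elements `n` of `N_{2,m}`, and `[x, x] = w`. -/
def extTable (m : ℕ) (D : NIdx m → NIdx m → ℂ) (w : NIdx m → ℂ) :
    Option (NIdx m) → Option (NIdx m) → Option (NIdx m) → ℂ
  | some a, some b => extVec (NIdx.nTable m a b)
  | some a, none => extVec (D a)
  | none, some a => -extVec (D a)
  | none, none => extVec w

theorem deg_of_extVec {m : ℕ} {v : NIdx m → ℂ} {d : ZMod 2} (hv : ∀ k, v k ≠ 0 → k.deg = d)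
    (k : Option (NIdx m)) (h : extVec v k ≠ 0) : extDeg k = d := by
  cases k with
  | none => exact absurd rfl h
  | some k => exact hv k h

theorem deg_extTable {m : ℕ} {D : NIdx m → NIdx m → ℂ} {w : NIdx m → ℂ}
    (hD : ∀ a k, D a k ≠ 0 → k.deg = a.deg) (hw : ∀ k, w k ≠ 0 → k.deg = 0)
    (i j k : Option (NIdx m)) (h : extTable m D w i j k ≠ 0) :
    extDeg k = extDeg i + extDeg j := by
  cases i <;> cases j <;> simp only [extTable] at h
  case none.none => simpa [extDeg] using deg_of_extVec hw k h
  case none.some a => simpa [extDeg] using deg_of_extVec (hD a) k (neg_ne_zero.1 h)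
  case some.none a => simpa [extDeg] using deg_of_extVec (hD a) k h
  case some.some a b => simpa [extDeg] using deg_of_extVec (NIdx.deg_nTable a b) k h

/-- The superalgebra spanned by `N_{2,m}` and an even element `x`, in which
`[n, x] = -[x, n] = D n` for basis elements `n` of `N_{2,m}`, and `[x, x] = w`. -/
def superExt (m : ℕ) (D : NIdx m → NIdx m → ℂ) (w : NIdx m → ℂ)
    (hD : ∀ a k, D a k ≠ 0 → k.deg = a.deg) (hw : ∀ k, w k ≠ 0 → k.deg = 0) :
    Superalgebra (Option (NIdx m) → ℂ) :=
  Superalgebra.ofTable extDeg (extTable m D w) (deg_extTable hD hw)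

namespace NIdx

variable {m : ℕ}

/-- `e₁ ↦ e₁`, `e₂ ↦ 0`, `y_i ↦ (i - (m + 1) / 2) y_i`. -/
def D₁ (m : ℕ) : NIdx m → NIdx m → ℂ
  | e₁ => Pi.single e₁ 1
  | e₂ => 0
  | y i => Pi.single (y i) (((i : ℕ) + 1 : ℂ) - (m + 1) / 2)

/-- `e₁ ↦ e₁`, `e₂ ↦ α e₂`, `y_i ↦ (i + (α - m - 1) / 2) y_i`. -/
def D₂ (m : ℕ) (α : ℂ) : NIdx m → NIdx m → ℂ
  | e₁ => Pi.single e₁ 1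
  | e₂ => Pi.single e₂ α
  | y i => Pi.single (y i) (((i : ℕ) + 1 : ℂ) + (α - m - 1) / 2)

/-- `e₁ ↦ e₁ + e₂`, `e₂ ↦ e₂`, `y_i ↦ (i - m / 2) y_i`. -/
def D₃ (m : ℕ) : NIdx m → NIdx m → ℂ
  | e₁ => Pi.single e₁ 1 + Pi.single e₂ 1
  | e₂ => Pi.single e₂ 1
  | y i => Pi.single (y i) (((i : ℕ) + 1 : ℂ) - m / 2)

/-- `e₁ ↦ 0`, `e₂ ↦ 2 e₂`, `y_i ↦ y_i + ∑_{k ≥ 1} b_{2k} y_{i+2k-1}`, where the parameter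
`b_{2k}`, for `k = 1, ..., (m - 1) / 2`, is written `b (k - 1)`. -/
def D₄ (m : ℕ) (b : Fin ((m - 1) / 2) → ℂ) : NIdx m → NIdx m → ℂ
  | e₁ => 0
  | e₂ => Pi.single e₂ 2
  | y i => Pi.single (y i) 1 + ∑ k : Fin ((m - 1) / 2), b k • yVec m (i + 2 * k + 1)

theorem deg_D₁ (a k : NIdx m) (h : D₁ m a k ≠ 0) : k.deg = a.deg := by
  cases a <;> simp only [D₁] at h
  case e₂ => exact absurd rfl h
  all_goals exact deg_of_single h

theorem deg_D₂ (α : ℂ) (a k : NIdx m) (h : D₂ m α a k ≠ 0) : k.deg = a.deg := by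
  cases a <;> simp only [D₂] at h
  all_goals exact deg_of_single h

theorem deg_D₃ (a k : NIdx m) (h : D₃ m a k ≠ 0) : k.deg = a.deg := by
  cases a <;> simp only [D₃] at h
  case e₁ =>
    by_cases h1 : (Pi.single e₁ 1 : NIdx m → ℂ) k = 0
    · rw [Pi.add_apply, h1, zero_add] at h
      have h2 := deg_of_single h
      exact h2
    · exact deg_of_single h1
  all_goals exact deg_of_single h

theorem deg_D₄ (b : Fin ((m - 1) / 2) → ℂ) (a k : NIdx m) (h : D₄ m b a k ≠ 0) :
    k.deg = a.deg := by
  cases a <;> simp only [D₄] at h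
  case e₁ => exact absurd rfl h
  case e₂ => exact deg_of_single h
  case y i =>
    by_cases h1 : (Pi.single (y i) 1 : NIdx m → ℂ) k = 0
    · rw [Pi.add_apply, h1, zero_add, Finset.sum_apply] at h
      obtain ⟨t, -, ht⟩ := Finset.exists_ne_zero_of_sum_ne_zero h
      exact deg_of_yVec (right_ne_zero_of_mul ht)
    · exact deg_of_single h1

end NIdx

open NIdx

def superM₁ (m : ℕ) : Superalgebra (Option (NIdx m) → ℂ) :=
  superExt m (D₁ m) (Pi.single e₂ 1) deg_D₁ fun _ h => deg_of_single h

def superM₂ (m : ℕ) (α : ℂ) : Superalgebra (Option (NIdx m) → ℂ) :=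
  superExt m (D₂ m α) 0 (deg_D₂ α) fun _ h => absurd rfl h

def superM₃ (m : ℕ) : Superalgebra (Option (NIdx m) → ℂ) :=
  superExt m (D₃ m) 0 deg_D₃ fun _ h => absurd rfl h

def superM₄ (m : ℕ) (b : Fin ((m - 1) / 2) → ℂ) : Superalgebra (Option (NIdx m) → ℂ) :=
  superExt m (D₄ m b) 0 (deg_D₄ b) fun _ h => absurd rfl h

/-- `S` is an `(m + 3)`-dimensional solvable Leibniz superalgebra whose nilradical is isomorphic
to `N_{2,m}`. -/
def IsSolvableExtensionOfN (m : ℕ) {A : Type*} [AddCommGroup A] [Module ℂ A]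
    (S : Superalgebra A) : Prop :=
  S.IsLeibniz ∧ Module.finrank ℂ A = m + 3 ∧ S.IsSolvable ∧
    ∃ N : Submodule ℂ A, S.IsNilradical N ∧ (superN m).IsoIdeal S N

end

/-! Let `L` be such a superalgebra with nilradical `N`, of codimension one. A complement `x` of `N`
can be chosen even: an odd `x` would satisfy `[[u, x], x] = ½ [u, [x, x]]` with `[x, x]` in `N`,
which makes `L` nilpotent. Likewise an even `x` cannot map all of `N` into `[N, N]`.

The Leibniz identity then leaves little freedom. Elements `[x, n] + [n, x]` are killed by every left
multiplication, and inside `N` only multiples of `e₂` are, so left multiplication by `x` is minus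
the right one and `[x, x] = θ e₂` with `θ d = 0`. The right action is `e₁ ↦ a e₁ + b e₂`, `e₂ ↦ d
e₂`, `u ↦ P u` on odd vectors, where `P` satisfies `[P, shift] = a shift` and multiplies the form of
the odd part infinitesimally by `d`. Hence `P` is `a` times the grading plus a polynomial in the
shift with constant term `c`, `d = 2c + a(m - 1)`, and `(a, c) ≠ (0, 0)`. A `Frame` records these
data; equal data give isomorphic superalgebras.

If `a ≠ 0`, scale to `a = 1`. An eigenvector of `P` with leading term `y_1` and its translates
diagonalise `P`. Replacing `e₁` by `e₁ + q e₂` removes `b` unless `d = 1`, and `θ` survives only if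
`d = 0`; rescaling the odd part by a square root makes a surviving `b` or `θ` equal to `1`. This
gives `M₁`, `M₂` and `M₃`. If `a = 0`, scale to `c = 1`; the form kills the positive even powers of
the shift, which gives `M₄`, and `x ↦ x + s e₁` changes `b₂` at will.

Conversely, an isomorphism carries one frame to another, and two frames of one superalgebra differ
by a triangular change (`Frame.compare`). Its effect on `a`, `b`, `d`, `θ`, `P` separates the
families and yields the scaling law for the parameters. The main steps are `exists_even_complement`,
`exists_frame`, `exists_weightMap`, `exists_eq_polyMap` and `Frame.compare`. -/

section Classification

open NIdx

/-! ### Linear algebra of the odd part: shift, grading and form, with indices starting at `0`. -/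

namespace NIdx

/-- The coordinate vector `y_{k+1}` of the odd part of `N_{2,m}`, read as `0` when `k + 1 > m`. -/
noncomputable def oddVec (m k : ℕ) : Fin m → ℂ :=
  if h : k < m then Pi.single ⟨k, h⟩ 1 else 0

theorem oddVec_apply {m : ℕ} (k : ℕ) (i : Fin m) :
    oddVec m k i = if k = i then 1 else 0 := by
  unfold oddVec
  split_ifs with h1 h2 h2
  · subst h2; simp
  · rw [Pi.single_apply, if_neg]; rintro rfl; exact h2 rfl
  · exact absurd (h2 ▸ i.2) h1
  · rfl

theorem oddVec_coe {m : ℕ} (i : Fin m) : oddVec m i = Pi.single i 1 := by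
  simp [oddVec]

theorem oddVec_of_le {m k : ℕ} (h : m ≤ k) : oddVec m k = 0 := by
  simp [oddVec, not_lt.2 h]

theorem sum_smul_oddVec {m : ℕ} (u : Fin m → ℂ) : ∑ i : Fin m, u i • oddVec m i = u := by
  funext k
  simp [Finset.sum_apply, oddVec_apply, Fin.val_inj]

theorem oddVec_ext {m : ℕ} {M : Type*} [AddCommGroup M] [Module ℂ M]
    {f g : (Fin m → ℂ) →ₗ[ℂ] M} (h : ∀ k < m, f (oddVec m k) = g (oddVec m k)) : f = g := by
  ext u
  simpa [← oddVec_coe] using h u u.2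

/-- The shift `y_i ↦ y_{i+1}`. -/
noncomputable def shift (m : ℕ) : (Fin m → ℂ) →ₗ[ℂ] (Fin m → ℂ) :=
  ∑ i : Fin m, (LinearMap.proj i).smulRight (oddVec m (i + 1))

/-- The diagonal map `y_{i+1} ↦ i y_{i+1}`. -/
noncomputable def grade (m : ℕ) : (Fin m → ℂ) →ₗ[ℂ] (Fin m → ℂ) :=
  ∑ i : Fin m, (LinearMap.proj i).smulRight (((i : ℕ) : ℂ) • oddVec m i)

/-- The bilinear form `B` for which `[u, v] = B u v e₂` on the odd part of `N_{2,m}`. -/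
noncomputable def oddForm (m : ℕ) : (Fin m → ℂ) →ₗ[ℂ] (Fin m → ℂ) →ₗ[ℂ] ℂ :=
  ∑ i : Fin m, ∑ j : Fin m, if (i : ℕ) + j + 1 = m then
    (LinearMap.proj i).smulRight ((-1 : ℂ) ^ (j : ℕ) • LinearMap.proj j) else 0

variable {m : ℕ}

theorem shift_oddVec (k : ℕ) : shift m (oddVec m k) = oddVec m (k + 1) := by
  rcases lt_or_ge k m with h | h
  · simp only [shift, LinearMap.sum_apply, LinearMap.smulRight_apply, LinearMap.proj_apply,
      oddVec_apply, ite_smul, one_smul, zero_smul]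
    rw [Finset.sum_eq_single ⟨k, h⟩] <;> simp
    intro b hb hk
    exact absurd (Fin.ext hk.symm) hb
  · simp [oddVec_of_le h, oddVec_of_le (h.trans (Nat.le_succ k))]

theorem grade_oddVec (k : ℕ) : grade m (oddVec m k) = (k : ℂ) • oddVec m k := by
  rcases lt_or_ge k m with h | h
  · simp only [grade, LinearMap.sum_apply, LinearMap.smulRight_apply, LinearMap.proj_apply,
      oddVec_apply, ite_smul, one_smul, zero_smul]
    rw [Finset.sum_eq_single ⟨k, h⟩] <;> simp
    intro b hb hk
    exact absurd (Fin.ext hk.symm) hb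
  · simp [oddVec_of_le h]

theorem oddForm_oddVec (i j : ℕ) :
    oddForm m (oddVec m i) (oddVec m j) = if i + j + 1 = m then (-1) ^ j else 0 := by
  rcases lt_or_ge i m with hi | hi
  · rcases lt_or_ge j m with hj | hj
    · simp only [oddForm, LinearMap.sum_apply]
      rw [Finset.sum_eq_single ⟨i, hi⟩, Finset.sum_eq_single ⟨j, hj⟩]
      · split_ifs <;> simp [oddVec_apply]
      · intro b _ hb
        have : j ≠ b := fun h => hb (Fin.ext h.symm)
        split_ifs <;> simp [oddVec_apply, this]
      · simp
      · intro b _ hb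
        have : i ≠ b := fun h => hb (Fin.ext h.symm)
        refine Finset.sum_eq_zero fun c _ => ?_
        split_ifs <;> simp [oddVec_apply, this]
      · simp
    · rw [oddVec_of_le hj, map_zero, if_neg (by omega)]
  · rw [oddVec_of_le hi, map_zero, LinearMap.zero_apply, if_neg (by omega)]

theorem shift_pow_oddVec (n k : ℕ) : (shift m ^ n) (oddVec m k) = oddVec m (k + n) := by
  induction n with
  | zero => simp
  | succ n ih => rw [pow_succ', Module.End.mul_apply, ih, shift_oddVec]; rfl

theorem shift_pow_self : shift m ^ m = 0 :=
  oddVec_ext fun k _ => by rw [shift_pow_oddVec, oddVec_of_le (by omega)]; rfl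

theorem shift_pow_apply (n : ℕ) (u : Fin m → ℂ) (i : Fin m) :
    (shift m ^ n) u i = if h : n ≤ i then u ⟨i - n, by omega⟩ else 0 := by
  conv_lhs => rw [← sum_smul_oddVec u]
  simp only [map_sum, map_smul, shift_pow_oddVec, Finset.sum_apply, Pi.smul_apply, oddVec_apply,
    smul_eq_mul, mul_ite, mul_one, mul_zero]
  split_ifs with h
  · rw [Finset.sum_eq_single ⟨i - n, by omega⟩]
    · rw [if_pos]; simp only; omega
    · intro b _ hb
      rw [if_neg]; intro h1; apply hb; ext; simp only; omega
    · simp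
  · refine Finset.sum_eq_zero fun b _ => if_neg (by omega)

theorem grade_shift (u : Fin m → ℂ) :
    grade m (shift m u) = shift m (grade m u) + shift m u := by
  have : grade m ∘ₗ shift m = shift m ∘ₗ grade m + shift m :=
    oddVec_ext fun k _ => by
      simp only [LinearMap.comp_apply, LinearMap.add_apply, shift_oddVec, grade_oddVec, map_smul]
      push_cast; module
  exact LinearMap.congr_fun this u

theorem oddForm_ext {f g : (Fin m → ℂ) →ₗ[ℂ] (Fin m → ℂ) →ₗ[ℂ] ℂ}
    (h : ∀ i j, f (oddVec m i) (oddVec m j) = g (oddVec m i) (oddVec m j)) : f = g :=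
  oddVec_ext fun i _ => oddVec_ext fun j _ => h i j

/-- The alternating signs of the form make the shift skew, so its odd powers are skew and its even
powers self-adjoint. -/
theorem oddForm_shift (u v : Fin m → ℂ) :
    oddForm m (shift m u) v = -oddForm m u (shift m v) := by
  have : oddForm m ∘ₗ shift m = -(oddForm m).compl₂ (shift m) := oddForm_ext fun i j => by
    simp only [LinearMap.comp_apply, LinearMap.neg_apply, LinearMap.compl₂_apply, shift_oddVec,
      oddForm_oddVec]
    split_ifs <;> first | omega | ring
  exact LinearMap.congr_fun₂ this u v

theorem oddForm_shift_pow (n : ℕ) (u v : Fin m → ℂ) :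
    oddForm m ((shift m ^ n) u) v = (-1) ^ n * oddForm m u ((shift m ^ n) v) := by
  induction n generalizing v with
  | zero => simp
  | succ n ih =>
    rw [pow_succ' (shift m), Module.End.mul_apply, oddForm_shift, ih,
      ← Module.End.mul_apply (shift m ^ n), ← pow_succ, ← pow_succ']
    ring

/-- Nonzero values need `i + j = m - 1`, which is even, so `i` and `j` have the same parity and the
two signs agree. -/
theorem oddForm_symm (hodd : Odd m) (u v : Fin m → ℂ) : oddForm m u v = oddForm m v u := by
  have : oddForm m = (oddForm m).flip := oddForm_ext fun i j => by
    simp only [LinearMap.flip_apply, oddForm_oddVec]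
    by_cases h : i + j + 1 = m
    · rw [if_pos h, if_pos (by omega)]
      have h1 : Even (i + j) := by
        rcases hodd with ⟨k, hk⟩; exact ⟨k, by omega⟩
      rcases Nat.even_or_odd i with h2 | h2
      · rw [h2.neg_one_pow, ((Nat.even_add.1 h1).1 h2).neg_one_pow]
      · have h3 : Odd j := by
          rw [← Nat.not_even_iff_odd] at h2 ⊢
          exact fun h3 => h2 ((Nat.even_add.1 h1).2 h3)
        rw [h2.neg_one_pow, h3.neg_one_pow]
    · rw [if_neg h, if_neg (by omega)]
  exact LinearMap.congr_fun₂ this u v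

theorem oddForm_grade (u v : Fin m → ℂ) :
    oddForm m (grade m u) v + oddForm m u (grade m v) = (m - 1) * oddForm m u v := by
  have : oddForm m ∘ₗ grade m + (oddForm m).compl₂ (grade m) = ((m : ℂ) - 1) • oddForm m :=
    oddForm_ext fun i j => by
      simp only [LinearMap.comp_apply, LinearMap.add_apply, LinearMap.compl₂_apply, grade_oddVec,
        map_smul, LinearMap.smul_apply, oddForm_oddVec, smul_eq_mul]
      split_ifs with h
      · have : (m : ℂ) = i + j + 1 := by rw [← h]; push_cast; rfl
        rw [this]; ring
      · simp
  exact LinearMap.congr_fun₂ this u v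

/-- A map commuting with the shift is a polynomial in it. -/
theorem eq_sum_shift_pow {P : (Fin m → ℂ) →ₗ[ℂ] (Fin m → ℂ)}
    (hP : ∀ u, P (shift m u) = shift m (P u)) :
    P = ∑ j : Fin m, P (oddVec m 0) j • shift m ^ (j : ℕ) := by
  have key : ∀ n u, P ((shift m ^ n) u) = (shift m ^ n) (P u) := by
    intro n u
    induction n with
    | zero => simp
    | succ n ih => rw [pow_succ', Module.End.mul_apply, hP, ih]; rfl
  refine oddVec_ext fun k _ => ?_
  -- The first basis vector is cyclic for the shift, so its image determines `P`.
  have h0 : oddVec m k = (shift m ^ k) (oddVec m 0) := by rw [shift_pow_oddVec, zero_add]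
  rw [h0, key]
  conv_lhs => rw [← sum_smul_oddVec (P (oddVec m 0))]
  simp only [map_sum, map_smul, LinearMap.sum_apply, LinearMap.smul_apply, shift_pow_oddVec]
  refine Finset.sum_congr rfl fun j _ => ?_
  rw [zero_add, add_comm]

/-- The shift is nilpotent. In `Frame.compare` this keeps `x` out of the new `e`. -/
theorem eq_zero_of_shift_eq_smul {u : Fin m → ℂ} {μ : ℂ} (hμ : μ ≠ 0)
    (h : shift m u = μ • u) : u = 0 := by
  have key : ∀ n, (shift m ^ n) u = μ ^ n • u := by
    intro n
    induction n with
    | zero => simp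
    | succ n ih =>
      rw [pow_succ', Module.End.mul_apply, ih, map_smul, h, smul_smul, pow_succ]
  have h1 := key m
  rw [shift_pow_self, LinearMap.zero_apply] at h1
  exact (smul_eq_zero.1 h1.symm).resolve_left (pow_ne_zero _ hμ)

theorem eq_zero_of_oddForm {u : Fin m → ℂ} (h : ∀ v, oddForm m v u = 0) : u = 0 := by
  funext i
  have h1 := h (oddVec m (m - 1 - i))
  rw [← sum_smul_oddVec u] at h1
  simp only [map_sum, map_smul, oddForm_oddVec, smul_eq_mul] at h1
  rw [Finset.sum_eq_single i] at h1
  · rw [if_pos (by omega)] at h1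
    simpa using h1
  · intro b _ hb
    rw [if_neg, mul_zero]
    intro h2; apply hb; ext; omega
  · simp

/-- The odd vectors inside the space of `N_{2,m}`. -/
noncomputable def oddIncl (m : ℕ) : (Fin m → ℂ) →ₗ[ℂ] (NIdx m → ℂ) where
  toFun u
    | y i => u i
    | _ => 0
  map_add' u v := by funext k; cases k <;> simp
  map_smul' r u := by funext k; cases k <;> simp

theorem oddIncl_oddVec (k : ℕ) : oddIncl m (oddVec m k) = yVec m k := by
  funext i
  unfold yVec
  cases i with
  | y i =>
    change oddVec m k i = _
    rw [oddVec_apply]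
    split_ifs with h1 h2 h2
    · subst h1; simp
    · exact absurd (h1 ▸ i.2) h2
    · rw [Pi.single_apply, if_neg]
      rintro ⟨⟩
      exact h1 rfl
    · rfl
  | _ =>
    change (0 : ℂ) = _
    split_ifs
    · rw [Pi.single_apply, if_neg nofun]
    · rfl

theorem oddIncl_single (i : Fin m) (r : ℂ) :
    oddIncl m (Pi.single i r) = Pi.single (y i) r := by
  have h : (Pi.single i r : Fin m → ℂ) = r • oddVec m i := by
    rw [oddVec_coe, ← Pi.single_smul, smul_eq_mul, mul_one]
  rw [h, map_smul, oddIncl_oddVec, yVec, dif_pos i.2, ← Pi.single_smul, smul_eq_mul, mul_one]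

theorem eq_single_add_oddIncl (v : NIdx m → ℂ) :
    v = v e₁ • Pi.single e₁ 1 + v e₂ • Pi.single e₂ 1 + oddIncl m fun i => v (y i) := by
  funext k
  cases k <;> simp [oddIncl]

end NIdx

/-! ### Frames: coordinates, isomorphisms and changes of frame. -/

namespace Superalgebra

variable {A : Type*} [AddCommGroup A] [Module ℂ A] {B : Type*} [AddCommGroup B] [Module ℂ B]

theorem eq_zero_of_mem_parts {S : Superalgebra A} {v : A} (h0 : v ∈ S.part 0)
    (h1 : v ∈ S.part 1) : v = 0 :=
  Submodule.disjoint_def.1 S.isCompl.disjoint v h0 h1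

/-- Elements of `S` that present it as an extension of `N_{2,m}` by `x`, with
`[e, x] = a e + b f`, `[f, x] = d f`, `[Y u, x] = Y (P u)` and `[x, x] = θ f`. -/
structure Frame (m : ℕ) (S : Superalgebra A) (a b d θ : ℂ)
    (P : (Fin m → ℂ) →ₗ[ℂ] (Fin m → ℂ)) where
  x : A
  e : A
  f : A
  Y : (Fin m → ℂ) →ₗ[ℂ] A
  x_mem : x ∈ S.part 0
  e_mem : e ∈ S.part 0
  f_mem : f ∈ S.part 0
  Y_mem : ∀ u, Y u ∈ S.part 1
  xx : S.mul x x = θ • f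
  ex : S.mul e x = a • e + b • f
  xe : S.mul x e = -(a • e + b • f)
  fx : S.mul f x = d • f
  xf : S.mul x f = -(d • f)
  Yx : ∀ u, S.mul (Y u) x = Y (P u)
  xY : ∀ u, S.mul x (Y u) = -Y (P u)
  ee : S.mul e e = 0
  ef : S.mul e f = 0
  fe : S.mul f e = 0
  ff : S.mul f f = 0
  Ye : ∀ u, S.mul (Y u) e = Y (shift m u)
  eY : ∀ u, S.mul e (Y u) = -Y (shift m u)
  Yf : ∀ u, S.mul (Y u) f = 0
  fY : ∀ u, S.mul f (Y u) = 0
  YY : ∀ u v, S.mul (Y u) (Y v) = oddForm m u v • f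
  indep : ∀ (ξ p q : ℂ) (u : Fin m → ℂ), ξ • x + p • e + q • f + Y u = 0 →
    ξ = 0 ∧ p = 0 ∧ q = 0 ∧ u = 0
  finrank_eq : Module.finrank ℂ A = m + 3

namespace Frame

variable {m : ℕ} {S : Superalgebra A} {T : Superalgebra B} {a b d θ : ℂ}
  {P : (Fin m → ℂ) →ₗ[ℂ] (Fin m → ℂ)}

/-- The linear combination of the elements of a frame with given coordinates. -/
def lin (F : Frame m S a b d θ P) : (ℂ × ℂ × ℂ × (Fin m → ℂ)) →ₗ[ℂ] A where
  toFun t := t.1 • F.x + t.2.1 • F.e + t.2.2.1 • F.f + F.Y t.2.2.2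
  map_add' s t := by simp only [Prod.fst_add, Prod.snd_add, map_add]; module
  map_smul' r t := by
    simp only [Prod.smul_fst, Prod.smul_snd, map_smul, smul_eq_mul, RingHom.id_apply]; module

theorem lin_apply (F : Frame m S a b d θ P) (ξ p q : ℂ) (u : Fin m → ℂ) :
    F.lin (ξ, p, q, u) = ξ • F.x + p • F.e + q • F.f + F.Y u := rfl

theorem lin_injective (F : Frame m S a b d θ P) : Function.Injective F.lin := by
  refine (injective_iff_map_eq_zero _).2 ?_
  rintro ⟨ξ, p, q, u⟩ h
  obtain ⟨rfl, rfl, rfl, rfl⟩ := F.indep ξ p q u h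
  rfl

/-- Coordinates with respect to a frame. -/
noncomputable def equiv (F : Frame m S a b d θ P) : (ℂ × ℂ × ℂ × (Fin m → ℂ)) ≃ₗ[ℂ] A :=
  haveI : FiniteDimensional ℂ A := Module.finite_of_finrank_pos (by rw [F.finrank_eq]; omega)
  LinearEquiv.ofBijective F.lin ⟨F.lin_injective,
    (LinearMap.injective_iff_surjective_of_finrank_eq_finrank (by
      rw [F.finrank_eq]; simp; omega)).1 F.lin_injective⟩

theorem equiv_apply (F : Frame m S a b d θ P) (ξ p q : ℂ) (u : Fin m → ℂ) :
    F.equiv (ξ, p, q, u) = ξ • F.x + p • F.e + q • F.f + F.Y u := rfl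

theorem exists_coords (F : Frame m S a b d θ P) (v : A) :
    ∃ (ξ p q : ℂ) (u : Fin m → ℂ), v = ξ • F.x + p • F.e + q • F.f + F.Y u := by
  obtain ⟨⟨ξ, p, q, u⟩, rfl⟩ := F.equiv.surjective v
  exact ⟨ξ, p, q, u, rfl⟩

theorem coords_inj (F : Frame m S a b d θ P) {ξ p q ξ' p' q' : ℂ} {u u' : Fin m → ℂ}
    (h : ξ • F.x + p • F.e + q • F.f + F.Y u = ξ' • F.x + p' • F.e + q' • F.f + F.Y u') :
    ξ = ξ' ∧ p = p' ∧ q = q' ∧ u = u' := by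
  have := F.lin_injective (a₁ := (ξ, p, q, u)) (a₂ := (ξ', p', q', u')) h
  simpa using this

theorem even_mem (F : Frame m S a b d θ P) (ξ p q : ℂ) :
    ξ • F.x + p • F.e + q • F.f ∈ S.part 0 :=
  add_mem (add_mem (Submodule.smul_mem _ _ F.x_mem) (Submodule.smul_mem _ _ F.e_mem))
    (Submodule.smul_mem _ _ F.f_mem)

theorem exists_of_mem_even (F : Frame m S a b d θ P) {v : A} (hv : v ∈ S.part 0) :
    ∃ ξ p q : ℂ, v = ξ • F.x + p • F.e + q • F.f := by
  obtain ⟨ξ, p, q, u, rfl⟩ := F.exists_coords v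
  have h1 : F.Y u ∈ S.part 0 := by
    simpa using sub_mem hv (F.even_mem ξ p q)
  refine ⟨ξ, p, q, ?_⟩
  rw [eq_zero_of_mem_parts h1 (F.Y_mem u), add_zero]

theorem exists_of_mem_odd (F : Frame m S a b d θ P) {v : A} (hv : v ∈ S.part 1) :
    ∃ u, v = F.Y u := by
  obtain ⟨ξ, p, q, u, rfl⟩ := F.exists_coords v
  have h1 : ξ • F.x + p • F.e + q • F.f ∈ S.part 1 := by
    simpa using sub_mem hv (F.Y_mem u)
  refine ⟨u, ?_⟩
  rw [eq_zero_of_mem_parts (F.even_mem ξ p q) h1, zero_add]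

theorem mul_lin (F : Frame m S a b d θ P) (ξ p q ξ' p' q' : ℂ) (u u' : Fin m → ℂ) :
    S.mul (ξ • F.x + p • F.e + q • F.f + F.Y u) (ξ' • F.x + p' • F.e + q' • F.f + F.Y u') =
      (0 : ℂ) • F.x + (a * (p * ξ' - ξ * p')) • F.e +
        (b * (p * ξ' - ξ * p') + d * (q * ξ' - ξ * q') + θ * (ξ * ξ') + oddForm m u u') • F.f +
        F.Y (p' • shift m u - p • shift m u' + ξ' • P u - ξ • P u') := by
  simp only [map_add, map_smul, map_sub, LinearMap.add_apply, LinearMap.smul_apply, F.xx, F.ex,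
    F.xe, F.fx, F.xf, F.Yx, F.xY, F.ee, F.ef, F.fe, F.ff, F.Ye, F.eY, F.Yf, F.fY, F.YY]
  module

/-- By `mul_lin` the product in coordinates depends only on the shared data, so matching coordinates
respects it. -/
theorem iso (F : Frame m S a b d θ P) (G : Frame m T a b d θ P) : S.Iso T := by
  have hF : ∀ (ξ p q : ℂ) (u : Fin m → ℂ), (F.equiv.symm ≪≫ₗ G.equiv) (ξ • F.x + p • F.e + q • F.f + F.Y u) =
      ξ • G.x + p • G.e + q • G.f + G.Y u := by
    intro ξ p q u
    rw [← F.equiv_apply, LinearEquiv.trans_apply, LinearEquiv.symm_apply_apply, G.equiv_apply]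
  refine ⟨F.equiv.symm ≪≫ₗ G.equiv, fun i v hv => ?_, fun v w => ?_⟩
  · fin_cases i
    · obtain ⟨ξ, p, q, rfl⟩ := F.exists_of_mem_even hv
      have := hF ξ p q 0
      rw [map_zero, map_zero, add_zero, add_zero] at this
      rw [this]
      exact G.even_mem ξ p q
    · obtain ⟨u, rfl⟩ := F.exists_of_mem_odd hv
      have := hF 0 0 0 u
      simp only [zero_smul, zero_add] at this
      rw [this]
      exact G.Y_mem u
  · obtain ⟨ξ, p, q, u, rfl⟩ := F.exists_coords v
    obtain ⟨ξ', p', q', u', rfl⟩ := F.exists_coords w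
    rw [F.mul_lin, hF, hF, hF, G.mul_lin]

/-- Transport of a frame along an isomorphism. -/
theorem map (F : Frame m S a b d θ P) (h : S.Iso T) : Nonempty (Frame m T a b d θ P) := by
  obtain ⟨g, hg, hm⟩ := h
  exact ⟨{
    x := g F.x
    e := g F.e
    f := g F.f
    Y := g.toLinearMap ∘ₗ F.Y
    x_mem := hg _ _ F.x_mem
    e_mem := hg _ _ F.e_mem
    f_mem := hg _ _ F.f_mem
    Y_mem u := hg _ _ (F.Y_mem u)
    xx := by rw [← hm, F.xx, map_smul]
    ex := by rw [← hm, F.ex, map_add, map_smul, map_smul]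
    xe := by rw [← hm, F.xe, map_neg, map_add, map_smul, map_smul]
    fx := by rw [← hm, F.fx, map_smul]
    xf := by rw [← hm, F.xf, map_neg, map_smul]
    Yx u := by simp [← hm, F.Yx]
    xY u := by simp [← hm, F.xY]
    ee := by rw [← hm, F.ee, map_zero]
    ef := by rw [← hm, F.ef, map_zero]
    fe := by rw [← hm, F.fe, map_zero]
    ff := by rw [← hm, F.ff, map_zero]
    Ye u := by simp [← hm, F.Ye]
    eY u := by simp [← hm, F.eY]
    Yf u := by simp [← hm, F.Yf]
    fY u := by simp [← hm, F.fY]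
    YY u v := by simp [← hm, F.YY]
    indep ξ p q u h := by
      refine F.indep ξ p q u (g.injective ?_)
      simpa using h
    finrank_eq := by rw [← g.finrank_eq, F.finrank_eq] }⟩

/-- Change of frame. -/
theorem change (F : Frame m S a b d θ P) {a' b' d' θ' : ℂ}
    {P' : (Fin m → ℂ) →ₗ[ℂ] (Fin m → ℂ)} (l s p q r : ℂ) (G : (Fin m → ℂ) →ₗ[ℂ] (Fin m → ℂ))
    (hl : l ≠ 0) (hp : p ≠ 0) (hr : r ≠ 0)
    (hGT : ∀ u, G (shift m u) = p • shift m (G u))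
    (hGB : ∀ u v, oddForm m (G u) (G v) = r * oddForm m u v)
    (hGP : ∀ u, G (P' u) = l • P (G u) + s • shift m (G u))
    (ha : l * a = a') (hb : l * (p * b + q * d) = a' * q + b' * r) (hd : l * d = d')
    (hθ : l * l * θ = θ' * r) : Nonempty (Frame m S a' b' d' θ' P') := by
  subst ha hd
  have h1 : (l * (p * b + q * d) - l * a * q) = b' * r := by rw [hb]; ring
  exact ⟨{
    x := l • F.x + s • F.e
    e := p • F.e + q • F.f
    f := r • F.f
    Y := F.Y ∘ₗ G
    x_mem := by simpa using F.even_mem l s 0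
    e_mem := by simpa using F.even_mem 0 p q
    f_mem := Submodule.smul_mem _ _ F.f_mem
    Y_mem u := F.Y_mem _
    -- The cross terms with `s` cancel because left and right multiplication by `x` on `e` are
    -- opposite.
    xx := by
      simp only [map_add, map_smul, LinearMap.add_apply, LinearMap.smul_apply, F.xx, F.ex, F.xe,
        F.ee, smul_smul, ← hθ]
      module
    ex := by
      simp only [map_add, map_smul, LinearMap.add_apply, LinearMap.smul_apply, F.ex, F.fx,
        F.ee, F.fe, smul_smul, ← h1]
      module
    xe := by
      simp only [map_add, map_smul, LinearMap.add_apply, LinearMap.smul_apply, F.xe, F.xf,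
        F.ee, F.ef, smul_smul, ← h1]
      module
    fx := by
      simp only [map_add, map_smul, LinearMap.smul_apply, F.fx, F.fe]
      module
    xf := by
      simp only [map_add, map_smul, LinearMap.add_apply, LinearMap.smul_apply, F.xf, F.ef]
      module
    Yx u := by
      simp only [LinearMap.comp_apply, map_add, map_smul, F.Yx, F.Ye, hGP]
    xY u := by
      simp only [LinearMap.comp_apply, map_add, map_smul, LinearMap.add_apply,
        LinearMap.smul_apply, F.xY, F.eY, hGP]
      module
    ee := by
      simp [F.ee, F.ef, F.fe, F.ff]
    ef := by simp [F.ef, F.ff]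
    fe := by simp [F.fe, F.ff]
    ff := by simp [F.ff]
    Ye u := by simp [F.Ye, F.Yf, hGT]
    eY u := by simp [F.eY, F.fY, hGT]
    Yf u := by simp [F.Yf]
    fY u := by simp [F.fY]
    YY u v := by simp only [LinearMap.comp_apply, F.YY, hGB]; module
    indep ξ p' q' u h := by
      have h2 : (ξ * l) • F.x + (ξ * s + p' * p) • F.e + (p' * q + q' * r) • F.f + F.Y (G u) = 0 := by
        rw [← h, LinearMap.comp_apply]; module
      obtain ⟨k1, k2, k3, k4⟩ := F.indep _ _ _ _ h2
      have k5 : ξ = 0 := (mul_eq_zero.1 k1).resolve_right hl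
      subst k5
      have k6 : p' = 0 := by simpa [hp] using k2
      subst k6
      -- `G` is injective because it rescales a nondegenerate form by `r ≠ 0`.
      refine ⟨rfl, rfl, by simpa [hr] using k3, eq_zero_of_oddForm fun v => ?_⟩
      have k7 := hGB v u
      rw [k4, map_zero] at k7
      exact (mul_eq_zero.1 k7.symm).resolve_left hr
    finrank_eq := F.finrank_eq }⟩

end Frame

end Superalgebra

/-! ### Frames of superalgebras given by multiplication tables. -/

theorem NIdx.card (m : ℕ) : Fintype.card (NIdx m) = m + 2 := by
  let g : NIdx m ≃ Option (Option (Fin m)) :=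
    { toFun := fun
        | e₁ => none
        | e₂ => some none
        | y i => some (some i)
      invFun := fun
        | none => e₁
        | some none => e₂
        | some (some i) => y i
      left_inv := fun k => by cases k <;> rfl
      right_inv := fun k => by rcases k with _ | _ | k <;> rfl }
  simp [Fintype.card_congr g]

namespace Superalgebra

theorem ofTable_mul_single {ι : Type*} [Fintype ι] [DecidableEq ι] (deg : ι → ZMod 2)
    (c : ι → ι → ι → ℂ) (hc : ∀ i j k, c i j k ≠ 0 → deg k = deg i + deg j) (i j : ι) :
    (ofTable deg c hc).mul (Pi.single i 1) (Pi.single j 1) = c i j := by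
  funext k
  change ∑ i', ∑ j', (Pi.single i 1 : ι → ℂ) i' * (Pi.single j 1 : ι → ℂ) j' * c i' j' k = _
  simp [Pi.single_apply]

theorem single_mem_part {ι : Type*} [Fintype ι] [DecidableEq ι] (deg : ι → ZMod 2)
    (c : ι → ι → ι → ℂ) (hc : ∀ i j k, c i j k ≠ 0 → deg k = deg i + deg j) (i : ι) (r : ℂ) :
    (Pi.single i r : ι → ℂ) ∈ (ofTable deg c hc).part (deg i) := by
  intro k hk
  rw [Pi.single_apply, if_neg]
  rintro rfl
  exact hk rfl

end Superalgebra

/-- The inclusion of `N_{2,m}` in the space enlarged by `x`. -/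
def extIncl (m : ℕ) : (NIdx m → ℂ) →ₗ[ℂ] (Option (NIdx m) → ℂ) where
  toFun := extVec
  map_add' u v := by funext k; cases k <;> simp [extVec]
  map_smul' r u := by funext k; cases k <;> simp [extVec]

theorem extIncl_single {m : ℕ} (k : NIdx m) (r : ℂ) :
    extIncl m (Pi.single k r) = Pi.single (some k) r := by
  funext i
  cases i with
  | none => simp [extIncl, extVec]
  | some i => simp [extIncl, extVec, Pi.single_apply]


-- From here on a model enters only through its frame data; both sides of each product rule are
-- linear, so basis vectors suffice.
open Superalgebra in
theorem superExt_frame {m : ℕ} {D : NIdx m → NIdx m → ℂ} {w : NIdx m → ℂ}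
    (hD : ∀ a k, D a k ≠ 0 → k.deg = a.deg) (hw : ∀ k, w k ≠ 0 → k.deg = 0)
    {a b d θ : ℂ} {P : (Fin m → ℂ) →ₗ[ℂ] (Fin m → ℂ)}
    (h₁ : D e₁ = a • Pi.single e₁ 1 + b • Pi.single e₂ 1) (h₂ : D e₂ = d • Pi.single e₂ 1)
    (hy : ∀ k : Fin m, D (y k) = oddIncl m (P (oddVec m k))) (hθ : w = θ • Pi.single e₂ 1) :
    Nonempty (Frame m (superExt m D w hD hw) a b d θ P) := by
  have hs : ∀ i j, (superExt m D w hD hw).mul (Pi.single i 1) (Pi.single j 1) =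
      extTable m D w i j := ofTable_mul_single _ _ _
  have hmem : ∀ i, (Pi.single i 1 : Option (NIdx m) → ℂ) ∈ (superExt m D w hD hw).part (extDeg i) :=
    fun i => single_mem_part _ _ _ i 1
  have hY : ∀ k : Fin m, extIncl m (oddIncl m (oddVec m k)) = Pi.single (some (y k)) 1 := by
    intro k; rw [oddVec_coe, oddIncl_single, extIncl_single]
  have ht : ∀ i j, extVec (nTable m i j) = extIncl m (nTable m i j) := fun _ _ => rfl
  have hx : ∀ i, extVec (D i) = extIncl m (D i) := fun _ => rfl
  refine ⟨{
    x := Pi.single none 1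
    e := Pi.single (some e₁) 1
    f := Pi.single (some e₂) 1
    Y := extIncl m ∘ₗ oddIncl m
    x_mem := hmem none
    e_mem := hmem (some e₁)
    f_mem := hmem (some e₂)
    Y_mem := fun u => ?_
    xx := ?_
    ex := ?_
    xe := ?_
    fx := ?_
    xf := ?_
    Yx := fun u => ?_
    xY := fun u => ?_
    ee := ?_
    ef := ?_
    fe := ?_
    ff := ?_
    Ye := fun u => ?_
    eY := fun u => ?_
    Yf := fun u => ?_
    fY := fun u => ?_
    YY := fun u v => ?_
    indep := fun ξ p q u h => ?_
    finrank_eq := by simp [NIdx.card] }⟩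
  · rintro (_ | _ | _ | k) hk
    · rfl
    · rfl
    · rfl
    · exact absurd rfl hk
  · rw [hs, ← extIncl_single, ← map_smul, ← hθ]; rfl
  · rw [hs, ← extIncl_single, ← extIncl_single, ← map_smul, ← map_smul, ← map_add, ← h₁]; rfl
  · rw [hs, ← extIncl_single, ← extIncl_single, ← map_smul, ← map_smul, ← map_add, ← h₁]; rfl
  · rw [hs, ← extIncl_single, ← map_smul, ← h₂]; rfl
  · rw [hs, ← extIncl_single, ← map_smul, ← h₂]; rfl
  · refine LinearMap.congr_fun (f := (superExt m D w hD hw).mul.flip (Pi.single none 1) ∘ₗ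
      (extIncl m ∘ₗ oddIncl m)) (g := (extIncl m ∘ₗ oddIncl m) ∘ₗ P) ?_ u
    refine oddVec_ext fun k hk => ?_
    have := hY ⟨k, hk⟩
    simp only [LinearMap.comp_apply, LinearMap.flip_apply] at this ⊢
    rw [this, hs]
    exact congrArg (extIncl m) (hy ⟨k, hk⟩)
  · refine LinearMap.congr_fun (f := (superExt m D w hD hw).mul (Pi.single none 1) ∘ₗ
      (extIncl m ∘ₗ oddIncl m)) (g := -((extIncl m ∘ₗ oddIncl m) ∘ₗ P)) ?_ u
    refine oddVec_ext fun k hk => ?_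
    have := hY ⟨k, hk⟩
    simp only [LinearMap.comp_apply, LinearMap.neg_apply] at this ⊢
    rw [this, hs]
    exact congrArg (fun v => -extIncl m v) (hy ⟨k, hk⟩)
  · rw [hs]; exact map_zero (extIncl m)
  · rw [hs]; exact map_zero (extIncl m)
  · rw [hs]; exact map_zero (extIncl m)
  · rw [hs]; exact map_zero (extIncl m)
  · refine LinearMap.congr_fun (f := (superExt m D w hD hw).mul.flip (Pi.single (some e₁) 1) ∘ₗ
      (extIncl m ∘ₗ oddIncl m)) (g := (extIncl m ∘ₗ oddIncl m) ∘ₗ shift m) ?_ u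
    refine oddVec_ext fun k hk => ?_
    have := hY ⟨k, hk⟩
    simp only [LinearMap.comp_apply, LinearMap.flip_apply] at this ⊢
    rw [this, hs, shift_oddVec, oddIncl_oddVec]
    rfl
  · refine LinearMap.congr_fun (f := (superExt m D w hD hw).mul (Pi.single (some e₁) 1) ∘ₗ
      (extIncl m ∘ₗ oddIncl m)) (g := -((extIncl m ∘ₗ oddIncl m) ∘ₗ shift m)) ?_ u
    refine oddVec_ext fun k hk => ?_
    have := hY ⟨k, hk⟩
    simp only [LinearMap.comp_apply, LinearMap.neg_apply] at this ⊢
    rw [this, hs, shift_oddVec, oddIncl_oddVec, ← map_neg]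
    rfl
  · refine LinearMap.congr_fun (f := (superExt m D w hD hw).mul.flip (Pi.single (some e₂) 1) ∘ₗ
      (extIncl m ∘ₗ oddIncl m)) (g := 0) ?_ u
    refine oddVec_ext fun k hk => ?_
    have := hY ⟨k, hk⟩
    simp only [LinearMap.comp_apply, LinearMap.flip_apply] at this ⊢
    rw [this, hs]; exact map_zero (extIncl m)
  · refine LinearMap.congr_fun (f := (superExt m D w hD hw).mul (Pi.single (some e₂) 1) ∘ₗ
      (extIncl m ∘ₗ oddIncl m)) (g := 0) ?_ u
    refine oddVec_ext fun k hk => ?_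
    have := hY ⟨k, hk⟩
    simp only [LinearMap.comp_apply] at this ⊢
    rw [this, hs]; exact map_zero (extIncl m)
  · refine LinearMap.congr_fun₂ (f := (superExt m D w hD hw).mul.compl₁₂
      (extIncl m ∘ₗ oddIncl m) (extIncl m ∘ₗ oddIncl m))
      (g := (oddForm m).compr₂ ((LinearMap.id : ℂ →ₗ[ℂ] ℂ).smulRight
        (Pi.single (some e₂) 1 : Option (NIdx m) → ℂ))) ?_ u v
    refine oddVec_ext fun i hi => oddVec_ext fun j hj => ?_
    have h1 := hY ⟨i, hi⟩
    have h2 := hY ⟨j, hj⟩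
    simp only [LinearMap.compl₁₂_apply, LinearMap.comp_apply, LinearMap.compr₂_apply,
      LinearMap.smulRight_apply, LinearMap.id_apply] at h1 h2 ⊢
    rw [h1, h2, hs, oddForm_oddVec, extTable, ht, nTable]
    simp only
    split_ifs
    · rw [extIncl_single, ← Pi.single_smul, smul_eq_mul, mul_one]
    · simp
  · have h0 := congrFun h none
    have h1 := congrFun h (some e₁)
    have h2 := congrFun h (some e₂)
    have h3 := fun k => congrFun h (some (y k))
    simp [extIncl, extVec, oddIncl] at h0 h1 h2 h3
    exact ⟨h0, h1, h2, funext h3⟩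

/-! ### From a frame to a solvable Leibniz superalgebra with nilradical `N_{2,m}`. -/

theorem ZMod.eq_zero_or_one : ∀ i : ZMod 2, i = 0 ∨ i = 1 := by decide

namespace Superalgebra
namespace Frame

variable {A : Type*} [AddCommGroup A] [Module ℂ A] {m : ℕ} {S : Superalgebra A} {a b d θ : ℂ}
  {P : (Fin m → ℂ) →ₗ[ℂ] (Fin m → ℂ)}

theorem mul_lin' (F : Frame m S a b d θ P) (ξ p q ξ' p' q' : ℂ) (u u' : Fin m → ℂ) :
    S.mul (F.lin (ξ, p, q, u)) (F.lin (ξ', p', q', u')) =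
      F.lin (0, a * (p * ξ' - ξ * p'),
        b * (p * ξ' - ξ * p') + d * (q * ξ' - ξ * q') + θ * (ξ * ξ') + oddForm m u u',
        p' • shift m u - p • shift m u' + ξ' • P u - ξ • P u') :=
  F.mul_lin ξ p q ξ' p' q' u u'

theorem isLeibniz (F : Frame m S a b d θ P) (hodd : Odd m)
    (hPT : ∀ u, P (shift m u) = shift m (P u) + a • shift m u)
    (hPB : ∀ u v, oddForm m (P u) v + oddForm m u (P v) = d * oddForm m u v)
    (hθ : θ * d = 0) : S.IsLeibniz := by
  intro i j u v w hv hw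
  have even : ∀ {v}, v ∈ S.part 0 → ∃ ξ p q : ℂ, v = F.lin (ξ, p, q, 0) := fun hv => by
    obtain ⟨ξ, p, q, rfl⟩ := F.exists_of_mem_even hv
    exact ⟨ξ, p, q, by rw [lin_apply, map_zero, add_zero]⟩
  have odd : ∀ {v}, v ∈ S.part 1 → ∃ u, v = F.lin (0, 0, 0, u) := fun hv => by
    obtain ⟨u, rfl⟩ := F.exists_of_mem_odd hv
    exact ⟨u, by simp [lin_apply]⟩
  obtain ⟨ξ, p, q, u, rfl⟩ : ∃ (ξ p q : ℂ) (u' : Fin m → ℂ), u = F.lin (ξ, p, q, u') :=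
    F.exists_coords u
  have h00 : (-1 : ℂ) ^ ((0 : ZMod 2).val * (0 : ZMod 2).val) = 1 := pow_zero _
  have h01 : (-1 : ℂ) ^ ((0 : ZMod 2).val * (1 : ZMod 2).val) = 1 := pow_zero _
  have h10 : (-1 : ℂ) ^ ((1 : ZMod 2).val * (0 : ZMod 2).val) = 1 := pow_zero _
  have h11 : (-1 : ℂ) ^ ((1 : ZMod 2).val * (1 : ZMod 2).val) = -1 := pow_one _
  have hPB' : ∀ u v, oddForm m u (P v) = d * oddForm m u v - oddForm m (P u) v :=
    fun u v => by rw [← hPB]; ring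
  rcases ZMod.eq_zero_or_one i with rfl | rfl <;> rcases ZMod.eq_zero_or_one j with rfl | rfl
  · obtain ⟨ξ₁, p₁, q₁, rfl⟩ := even hv
    obtain ⟨ξ₂, p₂, q₂, rfl⟩ := even hw
    rw [h00]
    simp only [F.mul_lin', ← map_smul, ← map_sub, Prod.mk_sub_mk, Prod.smul_mk, smul_eq_mul]
    congr 1
    refine Prod.ext ?_ (Prod.ext ?_ (Prod.ext ?_ ?_)) <;> simp [hPT]
    · ring
    -- The `x`, `x`, `x` component is the only one that needs `θ d = 0`.
    · linear_combination (-ξ * ξ₁ * ξ₂) * hθ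
    · module
  · obtain ⟨ξ₁, p₁, q₁, rfl⟩ := even hv
    obtain ⟨u₂, rfl⟩ := odd hw
    rw [h01]
    simp only [F.mul_lin', ← map_smul, ← map_sub, Prod.mk_sub_mk, Prod.smul_mk, smul_eq_mul]
    congr 1
    refine Prod.ext ?_ (Prod.ext ?_ (Prod.ext ?_ ?_)) <;> simp [hPT, hPB', oddForm_shift]
    · ring
    · module
  · obtain ⟨ξ₂, p₂, q₂, rfl⟩ := even hw
    obtain ⟨u₁, rfl⟩ := odd hv
    rw [h10]
    simp only [F.mul_lin', ← map_smul, ← map_sub, Prod.mk_sub_mk, Prod.smul_mk, smul_eq_mul]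
    congr 1
    refine Prod.ext ?_ (Prod.ext ?_ (Prod.ext ?_ ?_)) <;> simp [hPT, hPB', oddForm_shift]
    · ring
    · module
  · obtain ⟨u₁, rfl⟩ := odd hv
    obtain ⟨u₂, rfl⟩ := odd hw
    rw [h11]
    simp only [F.mul_lin', ← map_smul, ← map_sub, Prod.mk_sub_mk, Prod.smul_mk, smul_eq_mul]
    congr 1
    refine Prod.ext ?_ (Prod.ext ?_ (Prod.ext ?_ ?_)) <;>
      simp [oddForm_shift, oddForm_symm hodd u₂]
    have h := hPB u₁ u₂
    rw [oddForm_symm hodd u₁ (P u₂)] at h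
    linear_combination ξ * h

/-- The span of the elements `e`, `f` and `Y u` of a frame. -/
def ideal (F : Frame m S a b d θ P) : Submodule ℂ A :=
  Submodule.map F.lin (LinearMap.ker (LinearMap.fst ℂ ℂ (ℂ × ℂ × (Fin m → ℂ))))

theorem mem_ideal (F : Frame m S a b d θ P) {v : A} :
    v ∈ F.ideal ↔ ∃ (p q : ℂ) (u : Fin m → ℂ), v = F.lin (0, p, q, u) := by
  constructor
  · rintro ⟨⟨ξ, p, q, u⟩, h, rfl⟩
    obtain rfl : ξ = 0 := h
    exact ⟨p, q, u, rfl⟩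
  · rintro ⟨p, q, u, rfl⟩
    exact ⟨_, rfl, rfl⟩

theorem mul_mem_ideal (F : Frame m S a b d θ P) (v w : A) : S.mul v w ∈ F.ideal := by
  obtain ⟨ξ, p, q, u, rfl⟩ := F.exists_coords v
  obtain ⟨ξ', p', q', u', rfl⟩ := F.exists_coords w
  rw [← lin_apply, ← lin_apply, mul_lin']
  exact F.mem_ideal.2 ⟨_, _, _, rfl⟩

/-- The descending chain of ideals spanned by `f` and the `y_{i+1}` with `i ≥ n`. -/
noncomputable def chain (F : Frame m S a b d θ P) (n : ℕ) : Submodule ℂ A :=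
  Submodule.map F.lin (Submodule.prod ⊥ (Submodule.prod ⊥
    (Submodule.prod ⊤ (LinearMap.range (shift m ^ n)))))

theorem mem_chain (F : Frame m S a b d θ P) {n : ℕ} {v : A} :
    v ∈ F.chain n ↔ ∃ (q : ℂ) (u : Fin m → ℂ), v = F.lin (0, 0, q, (shift m ^ n) u) := by
  constructor
  · rintro ⟨⟨ξ, p, q, u⟩, ⟨h1, h2, -, u', rfl⟩, rfl⟩
    obtain rfl : ξ = 0 := h1
    obtain rfl : p = 0 := h2
    exact ⟨q, u', rfl⟩
  · rintro ⟨q, u, rfl⟩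
    exact ⟨_, ⟨Submodule.zero_mem _, Submodule.zero_mem _, trivial, u, rfl⟩, rfl⟩

theorem lin_mem_chain (F : Frame m S a b d θ P) {n : ℕ} {ξ p q : ℂ} {u w : Fin m → ℂ}
    (hξ : ξ = 0) (hp : p = 0) (hw : w = (shift m ^ n) u) : F.lin (ξ, p, q, w) ∈ F.chain n := by
  subst hξ hp hw
  exact F.mem_chain.2 ⟨q, u, rfl⟩

theorem mul_mem_chain_one (F : Frame m S a b d θ P) {v w : A} (hv : v ∈ F.ideal)
    (hw : w ∈ F.ideal) : S.mul v w ∈ F.chain 1 := by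
  obtain ⟨p, q, u, rfl⟩ := F.mem_ideal.1 hv
  obtain ⟨p', q', u', rfl⟩ := F.mem_ideal.1 hw
  rw [F.mul_lin']
  exact F.lin_mem_chain (u := p' • u - p • u') rfl (by simp) (by simp)

theorem mul_mem_chain (F : Frame m S a b d θ P) {n : ℕ} {v w : A} (hv : v ∈ F.chain n)
    (hw : w ∈ F.ideal) : S.mul v w ∈ F.chain (n + 1) := by
  obtain ⟨q, u, rfl⟩ := F.mem_chain.1 hv
  obtain ⟨p', q', u', rfl⟩ := F.mem_ideal.1 hw
  rw [F.mul_lin']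
  exact F.lin_mem_chain (u := p' • u) rfl (by simp) (by simp [pow_succ'])

theorem mul_eq_zero_of_chain (F : Frame m S a b d θ P) {v w : A} (hv : v ∈ F.chain m)
    (hw : w ∈ F.ideal) : S.mul v w = 0 := by
  obtain ⟨q, u, rfl⟩ := F.mem_chain.1 hv
  obtain ⟨p', q', u', rfl⟩ := F.mem_ideal.1 hw
  rw [F.mul_lin']
  simp [shift_pow_self, lin_apply]

theorem chain_le_ideal (F : Frame m S a b d θ P) (n : ℕ) : F.chain n ≤ F.ideal := by
  intro v hv
  obtain ⟨q, u, rfl⟩ := F.mem_chain.1 hv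
  exact F.mem_ideal.2 ⟨_, _, _, rfl⟩

theorem ideal_isNilpotentSub (F : Frame m S a b d θ P) : S.IsNilpotentSub F.ideal := by
  have h : ∀ n, S.lowerCentralSeries F.ideal (n + 1) ≤ F.chain (n + 1) := by
    intro n
    induction n with
    | zero => exact Submodule.map₂_le.2 fun v hv w hw => F.mul_mem_chain_one hv hw
    | succ n ih => exact Submodule.map₂_le.2 fun v hv w hw => F.mul_mem_chain (ih hv) hw
  refine ⟨m + 1, ?_⟩
  -- The bound `h` starts at index `1`, so it reaches `chain m` only for `m ≥ 1`; without odd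
  -- vectors the first product already vanishes.
  rcases m with _ | m
  · refine eq_bot_iff.2 (Submodule.map₂_le.2 fun v hv w hw => ?_)
    obtain ⟨p, q, u, rfl⟩ := F.mem_ideal.1 hv
    obtain ⟨p', q', u', rfl⟩ := F.mem_ideal.1 hw
    rw [F.mul_lin', Submodule.mem_bot, Subsingleton.elim u 0]
    simp [lin_apply, Subsingleton.elim (shift 0 u') 0, -Matrix.zero_empty]
  · exact eq_bot_iff.2 (Submodule.map₂_le.2 fun v hv w hw => by
      rw [F.mul_eq_zero_of_chain (h m hv) hw]; exact zero_mem _)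

theorem isSolvable (F : Frame m S a b d θ P) : S.IsSolvable := by
  -- Successive derived terms lose `x`, then `e`, then all odd vectors, and the remaining multiples
  -- of `f` multiply to zero.
  have h1 : S.derivedSeries 1 ≤ F.ideal := Submodule.map₂_le.2 fun v _ w _ => F.mul_mem_ideal v w
  have h2 : S.derivedSeries 2 ≤ F.chain 0 := Submodule.map₂_le.2 fun v hv w hw => by
    obtain ⟨q, u, h⟩ := F.mem_chain.1 (F.mul_mem_chain_one (h1 hv) (h1 hw))
    exact F.mem_chain.2 ⟨q, (shift m ^ 1) u, h⟩
  have h3 : S.derivedSeries 3 ≤ F.chain m := Submodule.map₂_le.2 fun v hv w hw => by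
    obtain ⟨q, u, rfl⟩ := F.mem_chain.1 (h2 hv)
    obtain ⟨q', u', rfl⟩ := F.mem_chain.1 (h2 hw)
    rw [F.mul_lin']
    exact F.lin_mem_chain (u := 0) rfl (by simp) (by simp)
  exact ⟨4, eq_bot_iff.2 (Submodule.map₂_le.2 fun v hv w hw => by
    rw [F.mul_eq_zero_of_chain (h3 hv) (F.chain_le_ideal m (h3 hw))]; exact zero_mem _)⟩

theorem ideal_isIdeal (F : Frame m S a b d θ P) : S.IsIdeal F.ideal where
  graded := fun v hv => by
    obtain ⟨p, q, u, rfl⟩ := F.mem_ideal.1 hv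
    refine Submodule.mem_sup.2 ⟨F.lin (0, p, q, 0), ⟨F.mem_ideal.2 ⟨_, _, _, rfl⟩, ?_⟩,
      F.lin (0, 0, 0, u), ⟨F.mem_ideal.2 ⟨_, _, _, rfl⟩, ?_⟩, ?_⟩
    · have := F.even_mem 0 p q
      rwa [lin_apply, map_zero, add_zero]
    · simpa [lin_apply] using F.Y_mem u
    · rw [← map_add]; simp
  mul_right := fun v _ w => F.mul_mem_ideal v w
  mul_left := fun v _ w => F.mul_mem_ideal w v

/-- A strictly larger ideal contains `x`, and then `v = μ⁻¹ [v, x]` lies in every term of its lower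
central series. -/
theorem ideal_isNilradical (F : Frame m S a b d θ P) {v : A} {μ : ℂ} (hv : v ≠ 0) (hμ : μ ≠ 0)
    (hvx : S.mul v F.x = μ • v) : S.IsNilradical F.ideal := by
  refine ⟨⟨F.ideal_isIdeal, F.ideal_isNilpotentSub,
    Submodule.map₂_le.2 fun v _ w _ => F.mul_mem_ideal v w⟩, ?_⟩
  rintro I ⟨hI, ⟨n, hn⟩, -⟩ hle w hw
  obtain ⟨ξ, p, q, u, rfl⟩ := F.exists_coords w
  by_cases hξ : ξ = 0
  · subst hξ
    exact F.mem_ideal.2 ⟨_, _, _, rfl⟩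
  exfalso
  have hx : F.x ∈ I := by
    have h1 : F.lin (0, p, q, u) ∈ I := hle (F.mem_ideal.2 ⟨_, _, _, rfl⟩)
    have h2 := I.smul_mem ξ⁻¹ (I.sub_mem hw h1)
    have h3 : ξ⁻¹ • (ξ • F.x + p • F.e + q • F.f + F.Y u - F.lin (0, p, q, u)) = F.x := by
      rw [lin_apply, show ξ • F.x + p • F.e + q • F.f + F.Y u -
        ((0 : ℂ) • F.x + p • F.e + q • F.f + F.Y u) = ξ • F.x by module, smul_smul,
        inv_mul_cancel₀ hξ, one_smul]
    rwa [h3] at h2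
  have hv' : v = μ⁻¹ • S.mul v F.x := by rw [hvx, smul_smul, inv_mul_cancel₀ hμ, one_smul]
  have h : ∀ k, v ∈ S.lowerCentralSeries I k := by
    intro k
    induction k with
    | zero => rw [hv']; exact I.smul_mem _ (hI.mul_left _ hx v)
    | succ k ih =>
      rw [hv']
      exact Submodule.smul_mem _ _ (Submodule.apply_mem_map₂ _ ih hx)
  have := h n
  rw [hn] at this
  exact hv this

theorem isoIdeal (F : Frame m S a b d θ P) : (superN m).IsoIdeal S F.ideal := by
  let g₀ : (NIdx m → ℂ) →ₗ[ℂ] A :=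
    { toFun := fun v => F.lin (0, v e₁, v e₂, fun i => v (y i))
      map_add' := fun v w => by rw [← map_add]; congr 1; simp; rfl
      map_smul' := fun r v => by rw [← map_smul]; congr 1; simp; rfl }
  have hg₀ : ∀ v, g₀ v = F.lin (0, v e₁, v e₂, fun i => v (y i)) := fun _ => rfl
  let g := g₀.codRestrict F.ideal fun v => F.mem_ideal.2 ⟨_, _, _, rfl⟩
  have hg : Function.Bijective g := by
    constructor
    · intro v w h
      have h1 : g₀ v = g₀ w := congrArg Subtype.val h
      have h2 := F.lin_injective h1
      simp only [Prod.mk.injEq, true_and] at h2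
      funext k
      cases k with
      | e₁ => exact h2.1
      | e₂ => exact h2.2.1
      | y i => exact congrFun h2.2.2 i
    · rintro ⟨w, hw⟩
      obtain ⟨p, q, u, rfl⟩ := F.mem_ideal.1 hw
      exact ⟨fun k => match k with
        | e₁ => p
        | e₂ => q
        | y i => u i, rfl⟩
  have h1 : g₀ (Pi.single e₁ 1) = F.e := by
    have : (fun i : Fin m => (Pi.single e₁ 1 : NIdx m → ℂ) (y i)) = 0 := funext fun i => by simp
    rw [hg₀, this]; simp [lin_apply]
  have h2 : g₀ (Pi.single e₂ 1) = F.f := by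
    have : (fun i : Fin m => (Pi.single e₂ 1 : NIdx m → ℂ) (y i)) = 0 := funext fun i => by simp
    rw [hg₀, this]; simp [lin_apply]
  have h3 : ∀ u, g₀ (oddIncl m u) = F.Y u := by
    intro u
    change (0 : ℂ) • F.x + (0 : ℂ) • F.e + (0 : ℂ) • F.f + F.Y u = _
    simp
  have h4 : ∀ i, g₀ (Pi.single (y i) 1) = F.Y (oddVec m i) := by
    intro i; rw [← h3, oddVec_coe, oddIncl_single]
  refine ⟨LinearEquiv.ofBijective g hg, fun i v hv => ?_, fun v w => ?_⟩
  · change g₀ v ∈ _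
    rcases ZMod.eq_zero_or_one i with rfl | rfl
    · have : (fun i => v (y i)) = 0 := funext fun i => hv (y i) (by simp [deg])
      rw [hg₀, this, lin_apply, map_zero, add_zero]
      exact F.even_mem _ _ _
    · have k1 : v e₁ = 0 := hv e₁ (by simp [deg])
      have k2 : v e₂ = 0 := hv e₂ (by simp [deg])
      rw [hg₀, k1, k2, lin_apply]
      simp only [zero_smul, zero_add]
      exact F.Y_mem _
  · change g₀ _ = S.mul (g₀ v) (g₀ w)
    refine LinearMap.congr_fun₂ (f := (superN m).mul.compr₂ g₀) (g := S.mul.compl₁₂ g₀ g₀) ?_ v w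
    refine LinearMap.pi_ext' fun i => LinearMap.ext_ring (LinearMap.pi_ext' fun j =>
      LinearMap.ext_ring ?_)
    have hs : (superN m).mul (Pi.single i 1) (Pi.single j 1) = nTable m i j :=
      ofTable_mul_single _ _ _ i j
    change g₀ ((superN m).mul (Pi.single i 1) (Pi.single j 1)) =
      S.mul (g₀ (Pi.single i 1)) (g₀ (Pi.single j 1))
    rw [hs]
    cases i <;> cases j <;> simp only [h1, h2, h4, nTable, F.ee, F.ef, F.fe, F.ff, F.eY, F.Ye, F.Yf,
      F.fY, F.YY, map_zero, map_neg, ← oddIncl_oddVec, h3, shift_oddVec, oddForm_oddVec]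
    split_ifs
    · rw [← h2, ← map_smul, ← Pi.single_smul, smul_eq_mul, mul_one]
    · simp

theorem isSolvableExtension (F : Frame m S a b d θ P) (hodd : Odd m)
    (hPT : ∀ u, P (shift m u) = shift m (P u) + a • shift m u)
    (hPB : ∀ u v, oddForm m (P u) v + oddForm m u (P v) = d * oddForm m u v)
    (hθ : θ * d = 0) {v : A} {μ : ℂ} (hv : v ≠ 0) (hμ : μ ≠ 0)
    (hvx : S.mul v F.x = μ • v) : IsSolvableExtensionOfN m S :=
  ⟨F.isLeibniz hodd hPT hPB hθ, F.finrank_eq, F.isSolvable, F.ideal,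
    F.ideal_isNilradical hv hμ hvx, F.isoIdeal⟩

end Frame
end Superalgebra

/-! ### Shape of the action of `x` on the odd part. -/

namespace NIdx

variable {m : ℕ} {P : (Fin m → ℂ) →ₗ[ℂ] (Fin m → ℂ)} {a d : ℂ}

/-- The multiple `a • grade m` has the same commutator with the shift, so the difference commutes
with the shift and is a polynomial in it. The grading kills `oddVec m 0`, so the coefficients are
those of `P`. -/
theorem eq_grade_add_sum (hPT : ∀ u, P (shift m u) = shift m (P u) + a • shift m u) :
    P = a • grade m + ∑ j : Fin m, P (oddVec m 0) j • shift m ^ (j : ℕ) := by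
  have h := eq_sum_shift_pow (P := P - a • grade m) fun u => by
    simp only [LinearMap.sub_apply, LinearMap.smul_apply, hPT, grade_shift, map_sub, map_smul]
    module
  have h0 : (P - a • grade m) (oddVec m 0) = P (oddVec m 0) := by
    simp [grade_oddVec]
  rw [h0] at h
  rw [← h]
  abel

theorem grade_apply (u : Fin m → ℂ) (i : Fin m) : grade m u i = i * u i := by
  conv_lhs => rw [← sum_smul_oddVec u]
  simp only [map_sum, map_smul, grade_oddVec, Finset.sum_apply, Pi.smul_apply, oddVec_apply,
    smul_eq_mul, mul_ite, mul_one, mul_zero]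
  rw [Finset.sum_eq_single i]
  · rw [if_pos rfl, mul_comm]
  · intro b _ hb
    rw [if_neg]; exact fun h => hb (Fin.ext h)
  · simp

/-- The lowest coefficient of `P u`. -/
theorem apply_lowest (hm : 0 < m) (hPT : ∀ u, P (shift m u) = shift m (P u) + a • shift m u)
    {u : Fin m → ℂ} {i : Fin m} (hu : ∀ j < i, u j = 0) :
    P u i = (P (oddVec m 0) ⟨0, hm⟩ + a * i) * u i := by
  have h := congrFun (LinearMap.congr_fun (eq_grade_add_sum hPT) u) i
  simp only [LinearMap.add_apply, LinearMap.smul_apply, LinearMap.sum_apply, Pi.add_apply,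
    Pi.smul_apply, Finset.sum_apply, smul_eq_mul, grade_apply, shift_pow_apply] at h
  rw [Finset.sum_eq_single ⟨0, hm⟩] at h
  · rw [h]; simp; ring
  · intro b _ hb
    split_ifs with hbi
    · rw [hu, mul_zero]
      rw [Fin.lt_def]
      have : (b : ℕ) ≠ 0 := fun h => hb (Fin.ext h)
      simp only; omega
    · rw [mul_zero]
  · simp

theorem exists_shift_eq {v : Fin m → ℂ} (hm : 0 < m) (hv : v ⟨0, hm⟩ = 0) :
    ∃ w, v = shift m w := by
  refine ⟨fun i => if h : (i : ℕ) + 1 < m then v ⟨i + 1, h⟩ else 0, funext fun i => ?_⟩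
  rw [← pow_one (shift m), shift_pow_apply]
  split_ifs with h1 h2
  · congr 1; ext; simp only; omega
  · simp only at h2; omega
  · rw [← hv]; congr 1; ext; simp only; omega

/-- Pairing the last basis vector with the first sees only the diagonal entries `c + a(m - 1)` and
`c` of `P`. -/
theorem weight_eq (hm : 0 < m) (hPT : ∀ u, P (shift m u) = shift m (P u) + a • shift m u)
    (hPB : ∀ u v, oddForm m (P u) v + oddForm m u (P v) = d * oddForm m u v) :
    d = 2 * P (oddVec m 0) ⟨0, hm⟩ + a * (m - 1) := by
  have h := hPB (oddVec m (m - 1)) (oddVec m 0)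
  rw [eq_grade_add_sum hPT] at h
  set c := P (oddVec m 0) with hc
  simp only [LinearMap.add_apply, LinearMap.smul_apply, LinearMap.sum_apply, map_add, map_sum,
    map_smul, grade_oddVec, shift_pow_oddVec, oddForm_oddVec, smul_eq_mul] at h
  rw [Finset.sum_eq_single ⟨0, hm⟩, Finset.sum_eq_single ⟨0, hm⟩] at h
  · rw [if_pos (by omega), if_pos (by simp; omega), if_pos (by simp; omega)] at h
    rw [Nat.cast_sub hm] at h
    simp at h
    linear_combination -h
  · intro b _ hb
    rw [if_neg, mul_zero]
    have : (b : ℕ) ≠ 0 := fun h => hb (Fin.ext h)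
    omega
  · simp
  · intro b _ hb
    rw [if_neg, mul_zero]
    have : (b : ℕ) ≠ 0 := fun h => hb (Fin.ext h)
    omega
  · simp

end NIdx

/-! ### Nilpotency criteria and the choice of an even complement of the nilradical. -/

namespace Superalgebra

variable {A : Type*} [AddCommGroup A] [Module ℂ A] {S : Superalgebra A} {N : Submodule ℂ A}
  {x : A}

theorem IsIdeal.exists_homogeneous (hN : S.IsIdeal N) {n : A} (hn : n ∈ N) :
    ∃ n₀ n₁, n₀ ∈ N ∧ n₀ ∈ S.part 0 ∧ n₁ ∈ N ∧ n₁ ∈ S.part 1 ∧ n = n₀ + n₁ := by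
  obtain ⟨n₀, h0, n₁, h1, rfl⟩ := Submodule.mem_sup.1 (hN.graded hn)
  exact ⟨n₀, n₁, h0.1, h0.2, h1.1, h1.2, rfl⟩

theorem mul_mem_lowerCentralSeries {k : ℕ} {u n : A} (hu : u ∈ S.lowerCentralSeries N k)
    (hn : n ∈ N) : S.mul u n ∈ S.lowerCentralSeries N (k + 1) :=
  Submodule.apply_mem_map₂ _ hu hn

theorem lowerCentralSeries_succ_le (hN : S.IsIdeal N) (k : ℕ) :
    S.lowerCentralSeries N (k + 1) ≤ S.lowerCentralSeries N k := by
  induction k with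
  | zero => exact Submodule.map₂_le.2 fun v hv w _ => hN.mul_right v hv w
  | succ k ih => exact Submodule.map₂_le_map₂_left ih

theorem lowerCentralSeries_succ_le_of_homogeneous (hN : S.IsIdeal N) {k : ℕ} {Q : Submodule ℂ A}
    (h : ∀ u ∈ S.lowerCentralSeries N k, ∀ i, ∀ n ∈ N, n ∈ S.part i → S.mul u n ∈ Q) :
    S.lowerCentralSeries N (k + 1) ≤ Q :=
  Submodule.map₂_le.2 fun u hu n hn => by
    obtain ⟨n₀, n₁, h0, h0', h1, h1', rfl⟩ := hN.exists_homogeneous hn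
    rw [map_add]
    exact Q.add_mem (h u hu 0 n₀ h0 h0') (h u hu 1 n₁ h1 h1')

/-- Right multiplication by a homogeneous element is a superderivation, so it preserves the series.
-/
theorem mul_right_mem_lowerCentralSeries (hL : S.IsLeibniz) (hN : S.IsIdeal N) {t : ZMod 2}
    (hx : x ∈ S.part t) {k : ℕ} {u : A} (hu : u ∈ S.lowerCentralSeries N k) :
    S.mul u x ∈ S.lowerCentralSeries N k := by
  induction k generalizing u with
  | zero => exact hN.mul_right u hu x
  | succ k ih =>
    refine (lowerCentralSeries_succ_le_of_homogeneous (Q := Submodule.comap (S.mul.flip x)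
      (S.lowerCentralSeries N (k + 1))) hN fun u hu i n hn hi => ?_) hu
    have h := hL i t u n x hi hx
    have h' : S.mul.flip x (S.mul u n) = S.mul u (S.mul n x) +
        (-1 : ℂ) ^ (i.val * t.val) • S.mul (S.mul u x) n := by
      rw [h, LinearMap.flip_apply]; abel
    rw [Submodule.mem_comap, h']
    exact add_mem (mul_mem_lowerCentralSeries hu (hN.mul_right n hn x))
      (Submodule.smul_mem _ _ (mul_mem_lowerCentralSeries (ih hu) hn))

/-- Two multiplications by elements of `N + ℂ x` descend at least one step in the series of `N`: a
factor from `N` descends by itself, and `hstep` covers `x` used twice. Hence the index `2 * k + 1`.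
-/
theorem isNilpotentSub_top (hL : S.IsLeibniz) (hN : S.IsIdeal N) (hnil : S.IsNilpotentSub N)
    {t : ZMod 2} (hx : x ∈ S.part t) (hNx : ∀ v, ∃ n ∈ N, ∃ c : ℂ, v = n + c • x)
    (hle : ∀ v w, S.mul v w ∈ N)
    (hstep : ∀ k, ∀ u ∈ S.lowerCentralSeries N k,
      S.mul (S.mul u x) x ∈ S.lowerCentralSeries N (k + 1)) : S.IsNilpotentSub ⊤ := by
  have h : ∀ k, S.lowerCentralSeries ⊤ (2 * k + 1) ≤ S.lowerCentralSeries N k := by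
    intro k
    induction k with
    | zero => exact Submodule.map₂_le.2 fun v _ w _ => hle v w
    | succ k ih =>
      refine Submodule.map₂_le.2 fun w hw l' _ => ?_
      have h1 : S.lowerCentralSeries ⊤ (2 * k + 2) ≤
          Submodule.comap (S.mul.flip l') (S.lowerCentralSeries N (k + 1)) := by
        refine Submodule.map₂_le.2 fun u hu l _ => ?_
        replace hu := ih hu
        obtain ⟨n, hn, c, rfl⟩ := hNx l
        obtain ⟨n', hn', c', rfl⟩ := hNx l'
        have k1 := mul_mem_lowerCentralSeries hu hn
        have k2 := mul_right_mem_lowerCentralSeries hL hN hx k1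
        have k3 := lowerCentralSeries_succ_le hN _ (mul_mem_lowerCentralSeries k1 hn')
        have k4 := mul_mem_lowerCentralSeries (mul_right_mem_lowerCentralSeries hL hN hx hu) hn'
        have k5 := hstep k u hu
        simp only [Submodule.mem_comap, LinearMap.flip_apply, map_add, map_smul,
          LinearMap.add_apply, LinearMap.smul_apply]
        exact add_mem (add_mem k3 (Submodule.smul_mem _ _ k2))
          (Submodule.smul_mem _ _ (add_mem k4 (Submodule.smul_mem _ _ k5)))
      exact h1 hw
  obtain ⟨n, hn⟩ := hnil
  exact ⟨2 * n + 1, eq_bot_iff.2 (hn ▸ h n)⟩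

/-- For odd `x` the sign in the identity gives `[u, [x, x]] = 2 [[u, x], x]`, and `[x, x]` lies in
`N`. -/
theorem isNilpotentSub_top_of_odd (hL : S.IsLeibniz) (hN : S.IsIdeal N)
    (hnil : S.IsNilpotentSub N) (hx : x ∈ S.part 1)
    (hNx : ∀ v, ∃ n ∈ N, ∃ c : ℂ, v = n + c • x) (hle : ∀ v w, S.mul v w ∈ N) :
    S.IsNilpotentSub ⊤ := by
  refine isNilpotentSub_top hL hN hnil hx hNx hle fun k u hu => ?_
  have h := hL 1 1 u x x hx hx
  rw [show (-1 : ℂ) ^ ((1 : ZMod 2).val * (1 : ZMod 2).val) = -1 from pow_one _] at h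
  have h' : S.mul (S.mul u x) x = (1 / 2 : ℂ) • S.mul u (S.mul x x) := by
    rw [h]; module
  rw [h']
  exact Submodule.smul_mem _ _ (mul_mem_lowerCentralSeries hu (hle x x))

/-- The Leibniz identity rewrites `[u, [n', n]]` through left-normed products with two factors from
`N`. -/
theorem mul_mem_lowerCentralSeries_add_two (hL : S.IsLeibniz) (hN : S.IsIdeal N) {k : ℕ} {u w : A}
    (hu : u ∈ S.lowerCentralSeries N k) (hw : w ∈ S.lowerCentralSeries N 1) :
    S.mul u w ∈ S.lowerCentralSeries N (k + 2) := by
  have h : S.lowerCentralSeries N 1 ≤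
      Submodule.comap (S.mul u) (S.lowerCentralSeries N (k + 2)) := by
    refine lowerCentralSeries_succ_le_of_homogeneous hN fun n' hn' j n hn hj => ?_
    obtain ⟨n₀, n₁, h0, h0', h1, h1', rfl⟩ := hN.exists_homogeneous hn'
    rw [Submodule.mem_comap, map_add, LinearMap.add_apply, map_add, hL _ _ u n₀ n h0' hj,
      hL _ _ u n₁ n h1' hj]
    exact add_mem
      (sub_mem (mul_mem_lowerCentralSeries (mul_mem_lowerCentralSeries hu h0) hn)
        (Submodule.smul_mem _ _ (mul_mem_lowerCentralSeries (mul_mem_lowerCentralSeries hu hn) h0)))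
      (sub_mem (mul_mem_lowerCentralSeries (mul_mem_lowerCentralSeries hu h1) hn)
        (Submodule.smul_mem _ _ (mul_mem_lowerCentralSeries (mul_mem_lowerCentralSeries hu hn) h1)))
  exact h hw

/-- If `x` maps `N` into `[N, N]`, the derivation rule makes it descend one step everywhere in the
series. -/
theorem isNilpotentSub_top_of_even (hL : S.IsLeibniz) (hN : S.IsIdeal N)
    (hnil : S.IsNilpotentSub N) (hx : x ∈ S.part 0)
    (hNx : ∀ v, ∃ n ∈ N, ∃ c : ℂ, v = n + c • x) (hle : ∀ v w, S.mul v w ∈ N)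
    (h1 : ∀ n ∈ N, S.mul n x ∈ S.lowerCentralSeries N 1) : S.IsNilpotentSub ⊤ := by
  have h : ∀ k, ∀ u ∈ S.lowerCentralSeries N k,
      S.mul u x ∈ S.lowerCentralSeries N (k + 1) := by
    intro k
    induction k with
    | zero => exact h1
    | succ k ih =>
      intro u hu
      refine (lowerCentralSeries_succ_le_of_homogeneous (Q := Submodule.comap (S.mul.flip x)
        (S.lowerCentralSeries N (k + 2))) hN fun u hu i n hn hi => ?_) hu
      have h' : S.mul.flip x (S.mul u n) = S.mul u (S.mul n x) +
          (-1 : ℂ) ^ (i.val * (0 : ZMod 2).val) • S.mul (S.mul u x) n := by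
        rw [hL i 0 u n x hi hx, LinearMap.flip_apply]; abel
      rw [Submodule.mem_comap, h']
      exact add_mem (mul_mem_lowerCentralSeries_add_two hL hN hu (h1 n hn))
        (Submodule.smul_mem _ _ (mul_mem_lowerCentralSeries (ih u hu) hn))
  exact isNilpotentSub_top hL hN hnil hx hNx hle fun k u hu =>
    mul_right_mem_lowerCentralSeries hL hN hx (h k u hu)

theorem isIdeal_top (S : Superalgebra A) : S.IsIdeal ⊤ where
  graded := by simp [S.isCompl.sup_eq_top]
  mul_right := fun _ _ _ => trivial
  mul_left := fun _ _ _ => trivial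

/-- By maximality of `N` the whole superalgebra is not nilpotent. The two criteria above therefore
put the odd part inside `N` and prevent `x` from mapping `N` into `[N, N]`. -/
theorem exists_even_complement {m : ℕ} (hL : S.IsLeibniz) (hA : Module.finrank ℂ A = m + 3)
    (hN : S.IsNilradical N) (hNm : Module.finrank ℂ N = m + 2) :
    ∃ x ∈ S.part 0, x ∉ N ∧ (∀ v, ∃ n ∈ N, ∃ c : ℂ, v = n + c • x) ∧
      ∃ n ∈ N, S.mul n x ∉ S.lowerCentralSeries N 1 := by
  have : FiniteDimensional ℂ A := Module.finite_of_finrank_pos (by omega)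
  obtain ⟨⟨hI, hnil, hle⟩, hmax⟩ := hN
  have hle' : ∀ v w, S.mul v w ∈ N := fun v w =>
    hle (Submodule.apply_mem_map₂ _ trivial trivial)
  have hne : ¬ (⊤ : Submodule ℂ A) ≤ N := fun h => by
    rw [top_le_iff.1 h, finrank_top] at hNm; omega
  have hnn : ¬ S.IsNilpotentSub ⊤ := fun h => hne (hmax ⟨S.isIdeal_top, h, le_top⟩ le_top)
  have hdec : ∀ x ∉ N, ∀ v, ∃ n ∈ N, ∃ c : ℂ, v = n + c • x := by
    intro x hx v
    have h1 : N < N ⊔ Submodule.span ℂ {x} := by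
      refine lt_of_le_of_ne le_sup_left fun h => hx ?_
      rw [h]
      exact Submodule.mem_sup_right (Submodule.mem_span_singleton_self x)
    have h2 := Submodule.finrank_lt_finrank_of_lt h1
    have h3 := Submodule.finrank_le (N ⊔ Submodule.span ℂ {x})
    have h4 : N ⊔ Submodule.span ℂ {x} = ⊤ := Submodule.eq_top_of_finrank_eq (by omega)
    obtain ⟨n, hn, w, hw, h⟩ := Submodule.mem_sup.1 (h4 ▸ Submodule.mem_top (x := v))
    obtain ⟨c, rfl⟩ := Submodule.mem_span_singleton.1 hw
    exact ⟨n, hn, c, h.symm⟩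
  have hodd : S.part 1 ≤ N := fun x hx => by
    by_contra hxN
    exact hnn (isNilpotentSub_top_of_odd hL hI hnil hx (hdec x hxN) hle')
  obtain ⟨x, hx, hxN⟩ : ∃ x ∈ S.part 0, x ∉ N := by
    by_contra! h
    exact hne (S.isCompl.sup_eq_top ▸ sup_le h hodd)
  refine ⟨x, hx, hxN, hdec x hxN, ?_⟩
  by_contra! h
  exact hnn (isNilpotentSub_top_of_even hL hI hnil hx (hdec x hxN) hle' h)

end Superalgebra

/-! ### Products of `N_{2,m}` in terms of the shift and the form. -/

theorem superN_mul_single {m : ℕ} (i j : NIdx m) :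
    (superN m).mul (Pi.single i 1) (Pi.single j 1) = nTable m i j :=
  Superalgebra.ofTable_mul_single _ _ _ i j

theorem superN_mul_odd_e₁ {m : ℕ} (u : Fin m → ℂ) :
    (superN m).mul (oddIncl m u) (Pi.single e₁ 1) = oddIncl m (shift m u) := by
  refine LinearMap.congr_fun (f := (superN m).mul.flip (Pi.single e₁ 1) ∘ₗ oddIncl m)
    (g := oddIncl m ∘ₗ shift m) (oddVec_ext fun k hk => ?_) u
  have h := superN_mul_single (y ⟨k, hk⟩) e₁
  rw [← oddIncl_single, ← oddVec_coe] at h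
  simpa [shift_oddVec, oddIncl_oddVec, nTable] using h

theorem superN_mul_e₁_odd {m : ℕ} (u : Fin m → ℂ) :
    (superN m).mul (Pi.single e₁ 1) (oddIncl m u) = -oddIncl m (shift m u) := by
  refine LinearMap.congr_fun (f := (superN m).mul (Pi.single e₁ 1) ∘ₗ oddIncl m)
    (g := -(oddIncl m ∘ₗ shift m)) (oddVec_ext fun k hk => ?_) u
  have h := superN_mul_single e₁ (y ⟨k, hk⟩)
  rw [← oddIncl_single, ← oddVec_coe] at h
  simpa [shift_oddVec, oddIncl_oddVec, nTable] using h

theorem superN_mul_odd_e₂ {m : ℕ} (u : Fin m → ℂ) :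
    (superN m).mul (oddIncl m u) (Pi.single e₂ 1) = 0 := by
  refine LinearMap.congr_fun (f := (superN m).mul.flip (Pi.single e₂ 1) ∘ₗ oddIncl m)
    (g := 0) (oddVec_ext fun k hk => ?_) u
  have h := superN_mul_single (y ⟨k, hk⟩) e₂
  rw [← oddIncl_single, ← oddVec_coe] at h
  exact h

theorem superN_mul_e₂_odd {m : ℕ} (u : Fin m → ℂ) :
    (superN m).mul (Pi.single e₂ 1) (oddIncl m u) = 0 := by
  refine LinearMap.congr_fun (f := (superN m).mul (Pi.single e₂ 1) ∘ₗ oddIncl m)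
    (g := 0) (oddVec_ext fun k hk => ?_) u
  have h := superN_mul_single e₂ (y ⟨k, hk⟩)
  rw [← oddIncl_single, ← oddVec_coe] at h
  exact h

theorem superN_mul_odd_odd {m : ℕ} (u v : Fin m → ℂ) :
    (superN m).mul (oddIncl m u) (oddIncl m v) = oddForm m u v • Pi.single e₂ 1 := by
  refine LinearMap.congr_fun₂ (f := (superN m).mul.compl₁₂ (oddIncl m) (oddIncl m))
      (g := (oddForm m).compr₂ ((LinearMap.id : ℂ →ₗ[ℂ] ℂ).smulRight
        (Pi.single e₂ 1 : NIdx m → ℂ))) ?_ u v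
  refine oddVec_ext fun i hi => oddVec_ext fun j hj => ?_
  have h := superN_mul_single (y ⟨i, hi⟩) (y ⟨j, hj⟩)
  rw [← oddIncl_single, ← oddVec_coe, ← oddIncl_single, ← oddVec_coe] at h
  simp only [LinearMap.compl₁₂_apply, LinearMap.compr₂_apply, LinearMap.smulRight_apply,
    LinearMap.id_apply]
  rw [h, oddForm_oddVec]
  simp only [nTable]
  split_ifs
  · rw [← Pi.single_smul, smul_eq_mul, mul_one]
  · rw [zero_smul]

/-! ### Every solvable extension has a frame. -/

namespace Superalgebra

variable {A : Type*} [AddCommGroup A] [Module ℂ A] {S : Superalgebra A} {N : Submodule ℂ A}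

theorem exists_of_isoIdeal {m : ℕ} (h : (superN m).IsoIdeal S N) :
    ∃ (e f : A) (Y : (Fin m → ℂ) →ₗ[ℂ] A), e ∈ S.part 0 ∧ f ∈ S.part 0 ∧ (∀ u, Y u ∈ S.part 1) ∧
      S.mul e e = 0 ∧ S.mul e f = 0 ∧ S.mul f e = 0 ∧ S.mul f f = 0 ∧
      (∀ u, S.mul (Y u) e = Y (shift m u)) ∧ (∀ u, S.mul e (Y u) = -Y (shift m u)) ∧
      (∀ u, S.mul (Y u) f = 0) ∧ (∀ u, S.mul f (Y u) = 0) ∧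
      (∀ u v, S.mul (Y u) (Y v) = oddForm m u v • f) ∧
      (∀ n, n ∈ N ↔ ∃ (p q : ℂ) (u : Fin m → ℂ), n = p • e + q • f + Y u) ∧
      (∀ (p q : ℂ) (u : Fin m → ℂ), p • e + q • f + Y u = 0 → p = 0 ∧ q = 0 ∧ u = 0) := by
  obtain ⟨g, hgd, hgm⟩ := h
  let G : (NIdx m → ℂ) →ₗ[ℂ] A := N.subtype ∘ₗ g.toLinearMap
  have hG : ∀ v w, S.mul (G v) (G w) = G ((superN m).mul v w) := fun v w => (hgm v w).symm
  have hGo : ∀ u, (G ∘ₗ oddIncl m) u = G (oddIncl m u) := fun _ => rfl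
  have hs : ∀ i j, S.mul (G (Pi.single i 1)) (G (Pi.single j 1)) = G (nTable m i j) :=
    fun i j => by rw [hG, superN_mul_single]
  refine ⟨G (Pi.single e₁ 1), G (Pi.single e₂ 1), G ∘ₗ oddIncl m,
    hgd 0 _ (single_mem_part _ _ _ e₁ 1), hgd 0 _ (single_mem_part _ _ _ e₂ 1),
    fun u => hgd 1 _ ?_, ?_, ?_, ?_, ?_, fun u => ?_, fun u => ?_, fun u => ?_, fun u => ?_,
    fun u v => ?_, fun n => ⟨fun hn => ?_, ?_⟩, fun p q u h => ?_⟩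
  · rintro (_ | _ | k) hk
    · rfl
    · rfl
    · exact absurd rfl hk
  · rw [hs]; exact map_zero G
  · rw [hs]; exact map_zero G
  · rw [hs]; exact map_zero G
  · rw [hs]; exact map_zero G
  · rw [hGo, hG, superN_mul_odd_e₁]; rfl
  · rw [hGo, hG, superN_mul_e₁_odd, map_neg]; rfl
  · rw [hGo, hG, superN_mul_odd_e₂, map_zero]
  · rw [hGo, hG, superN_mul_e₂_odd, map_zero]
  · rw [hGo, hGo, hG, superN_mul_odd_odd, map_smul]
  · obtain ⟨v, hv⟩ := g.surjective ⟨n, hn⟩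
    have hv' : G v = n := congrArg Subtype.val hv
    refine ⟨v e₁, v e₂, fun i => v (y i), ?_⟩
    rw [hGo, ← map_smul, ← map_smul, ← map_add, ← map_add,
      ← eq_single_add_oddIncl, hv']
  · rintro ⟨p, q, u, rfl⟩
    have h : ∀ v, G v ∈ N := fun v => (g v).2
    exact N.add_mem (N.add_mem (N.smul_mem _ (h _)) (N.smul_mem _ (h _))) (h _)
  · rw [hGo, ← map_smul, ← map_smul, ← map_add, ← map_add] at h
    have h' := g.injective (Subtype.ext (h.trans (by simp)) : _ = g 0)
    have k1 := congrFun h' e₁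
    have k2 := congrFun h' e₂
    have k3 := fun i => congrFun h' (y i)
    simp [oddIncl] at k1 k2 k3
    exact ⟨k1, k2, funext k3⟩

theorem exists_frame {m : ℕ} (hodd : Odd m) (hm : 3 ≤ m) (h : IsSolvableExtensionOfN m S) :
    ∃ (a b d θ : ℂ) (P : (Fin m → ℂ) →ₗ[ℂ] (Fin m → ℂ)), Nonempty (Frame m S a b d θ P) ∧
      (∀ u, P (shift m u) = shift m (P u) + a • shift m u) ∧
      (∀ u v, oddForm m (P u) v + oddForm m u (P v) = d * oddForm m u v) ∧
      θ * d = 0 ∧ ¬ (a = 0 ∧ P (oddVec m 0) ⟨0, by omega⟩ = 0) := by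
  obtain ⟨hL, hA, -, N, hN, hiso⟩ := h
  have hNm : Module.finrank ℂ N = m + 2 := by
    obtain ⟨g, -⟩ := hiso
    rw [← g.finrank_eq]; simp [NIdx.card]
  obtain ⟨x, hx, hxN, hdec, hnil⟩ := exists_even_complement hL hA hN hNm
  have hle : ∀ v w, S.mul v w ∈ N := fun v w =>
    hN.1.2.2 (Submodule.apply_mem_map₂ _ trivial trivial)
  obtain ⟨e, f, Y, he, hf, hY, ee, ef, fe, ff, Ye, eY, Yf, fY, YY, hmem, hind⟩ :=
    exists_of_isoIdeal hiso
  have hpq : ∀ p q : ℂ, p • e + q • f ∈ S.part 0 := fun p q =>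
    add_mem (Submodule.smul_mem _ _ he) (Submodule.smul_mem _ _ hf)
  have heven : ∀ n ∈ N, n ∈ S.part 0 → ∃ p q : ℂ, n = p • e + q • f := by
    intro n hn hn0
    obtain ⟨p, q, u, rfl⟩ := (hmem n).1 hn
    refine ⟨p, q, ?_⟩
    have : Y u ∈ S.part 0 := by simpa using sub_mem hn0 (hpq p q)
    rw [eq_zero_of_mem_parts this (hY u), add_zero]
  have hoddN : ∀ n ∈ N, n ∈ S.part 1 → ∃ u, n = Y u := by
    intro n hn hn1
    obtain ⟨p, q, u, rfl⟩ := (hmem n).1 hn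
    refine ⟨u, ?_⟩
    have : p • e + q • f ∈ S.part 1 := by simpa using sub_mem hn1 (hY u)
    rw [eq_zero_of_mem_parts (hpq p q) this, zero_add]
  have hf0 : ∀ c : ℂ, c • f = 0 → c = 0 := fun c hc => (hind 0 c 0 (by simpa using hc)).2.1
  have hYinj : ∀ u v, Y u = Y v → u = v := fun u v h =>
    sub_eq_zero.1 (hind 0 0 (u - v) (by simp [h])).2.2
  have hYx : ∀ u, ∃ w, S.mul (Y u) x = Y w := fun u =>
    hoddN _ (hle _ _) (S.mul_mem 1 0 _ _ (hY u) hx)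
  choose P₀ hP₀ using hYx
  let P : (Fin m → ℂ) →ₗ[ℂ] (Fin m → ℂ) :=
    { toFun := P₀
      map_add' := fun u v => hYinj _ _ (by
        rw [← hP₀, map_add, map_add, map_add, LinearMap.add_apply, hP₀, hP₀])
      map_smul' := fun r u => hYinj _ _ (by
        rw [← hP₀, map_smul, map_smul, map_smul, LinearMap.smul_apply, hP₀]; rfl) }
  have Yx : ∀ u, S.mul (Y u) x = Y (P u) := hP₀
  obtain ⟨a, b, ex⟩ := heven _ (hle e x) (S.mul_mem 0 0 _ _ he hx)
  have s0 : ∀ i : ZMod 2, (-1 : ℂ) ^ (i.val * (0 : ZMod 2).val) = 1 := fun i => pow_zero _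
  have s0' : ∀ i : ZMod 2, (-1 : ℂ) ^ ((0 : ZMod 2).val * i.val) = 1 := fun i => by
    rw [show (0 : ZMod 2).val * i.val = 0 from zero_mul _, pow_zero]
  have s1 : (-1 : ℂ) ^ ((1 : ZMod 2).val * (1 : ZMod 2).val) = -1 := pow_one _
  have hYYx : ∀ u v, oddForm m u v • S.mul f x =
      (oddForm m (P u) v + oddForm m u (P v)) • f := by
    intro u v
    have h := hL 1 0 (Y u) (Y v) x (hY v) hx
    rw [s0, Yx, Yx, YY, YY, YY, map_smul, LinearMap.smul_apply] at h
    rw [add_smul, h]; module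
  have hB1 : oddForm m (oddVec m (m - 1)) (oddVec m 0) = 1 := by
    rw [oddForm_oddVec, if_pos (by omega), pow_zero]
  obtain ⟨d, fx⟩ : ∃ d : ℂ, S.mul f x = d • f := by
    have h := hYYx (oddVec m (m - 1)) (oddVec m 0)
    rw [hB1, one_smul] at h
    exact ⟨_, h⟩
  have hPB : ∀ u v, oddForm m (P u) v + oddForm m u (P v) = d * oddForm m u v := by
    intro u v
    have h := hYYx u v
    rw [fx] at h
    refine sub_eq_zero.1 (hf0 _ ?_)
    rw [sub_smul, ← h]; module
  have hPT : ∀ u, P (shift m u) = shift m (P u) + a • shift m u := by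
    intro u
    have h := hL 0 0 (Y u) e x he hx
    rw [s0, ex, Ye, Yx, Yx, Ye, map_add, map_smul, map_smul, Ye, Yf] at h
    refine hYinj _ _ ?_
    rw [map_add, map_smul, ← sub_eq_iff_eq_add', ← one_smul ℂ (Y (shift m (P u))), ← h]
    simp
  -- The form detects the odd component of `z`, and the shift, nonzero as `m > 1`, detects its `e`
  -- component.
  have hann : ∀ z ∈ N, (∀ u, S.mul u z = 0) → ∃ q : ℂ, z = q • f := by
    intro z hz h
    obtain ⟨p, q, w, rfl⟩ := (hmem z).1 hz
    have h1 : ∀ u, p • shift m u = 0 ∧ oddForm m u w = 0 := by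
      intro u
      have h2 := h (Y u)
      rw [map_add, map_add, map_smul, map_smul, Ye, Yf, YY] at h2
      have h3 := hind 0 (oddForm m u w) (p • shift m u) (by rw [← h2, map_smul]; module)
      exact ⟨h3.2.2, h3.2.1⟩
    have hw : w = 0 := eq_zero_of_oddForm fun u => (h1 u).2
    have hp : p = 0 := by
      have h2 := congrFun (h1 (oddVec m 0)).1 ⟨1, by omega⟩
      simpa [shift_oddVec, oddVec_apply] using h2
    exact ⟨q, by rw [hw, hp, map_zero, zero_smul, zero_add, add_zero]⟩
  -- Since `x` is even, the expansions of `[u, [x, n]]` and `[u, [n, x]]` are opposite.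
  have hsq : ∀ (i : ZMod 2) (n : A), n ∈ S.part i → ∀ u,
      S.mul u (S.mul x n + S.mul n x) = 0 := by
    intro i n hn u
    rw [map_add, hL 0 i u x n hx hn, hL i 0 u n x hn hx, s0, s0']
    module
  have xY : ∀ u, S.mul x (Y u) = -Y (P u) := by
    intro u
    obtain ⟨q, hq⟩ := hann _ (add_mem (hle x (Y u)) (hle (Y u) x)) (hsq 1 _ (hY u))
    -- The defect is both a multiple of the even `f` and odd, hence zero.
    have h1 : q • f ∈ S.part 1 := by
      rw [← hq]
      exact add_mem (S.mul_mem 0 1 _ _ hx (hY u)) (S.mul_mem 1 0 _ _ (hY u) hx)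
    rw [eq_zero_of_mem_parts (Submodule.smul_mem _ _ hf) h1, Yx] at hq
    exact eq_neg_of_add_eq_zero_left hq
  have xf : S.mul x f = -(d • f) := by
    have h := hL 1 1 x (Y (oddVec m (m - 1))) (Y (oddVec m 0)) (hY _) (hY _)
    rw [s1, xY, xY, YY, hB1, one_smul, map_neg, map_neg, LinearMap.neg_apply, LinearMap.neg_apply,
      YY, YY] at h
    have h2 := hPB (oddVec m (m - 1)) (oddVec m 0)
    rw [hB1, oddForm_symm hodd _ (P (oddVec m 0)), mul_one] at h2
    rw [h, ← h2]; module
  obtain ⟨θ, xx⟩ : ∃ θ : ℂ, S.mul x x = θ • f := by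
    refine hann _ (hle x x) fun u => ?_
    have h := hsq 0 x hx u
    rw [map_add] at h
    have h2 : (2 : ℂ) • S.mul u (S.mul x x) = 0 := by rw [← h]; module
    simpa using h2
  have hθ : θ * d = 0 := by
    -- The identity gives `[x, [x, x]] = 0`, while `[x, θ f] = -θ d f`.
    have h := hL 0 0 x x x hx hx
    rw [s0, one_smul, sub_self, xx, map_smul, xf] at h
    refine hf0 _ ?_
    rw [← neg_eq_zero, ← h]; module
  -- Otherwise `d = 0` and `P` takes values in the image of the shift, so `x` would map `N` into
  -- `[N, N]`.
  have hnn : ¬ (a = 0 ∧ P (oddVec m 0) ⟨0, by omega⟩ = 0) := by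
    rintro ⟨rfl, hc⟩
    obtain ⟨n, hn, hn'⟩ := hnil
    refine hn' ?_
    have hd : d = 0 := by
      rw [weight_eq (by omega) hPT hPB, hc]; ring
    obtain ⟨p, q, u, rfl⟩ := (hmem n).1 hn
    have hYN : ∀ u, Y u ∈ N := fun u => (hmem _).2 ⟨0, 0, u, by simp⟩
    have heN : e ∈ N := (hmem _).2 ⟨1, 0, 0, by simp⟩
    have hf1 : f ∈ S.lowerCentralSeries N 1 := by
      have h := mul_mem_lowerCentralSeries (S := S) (k := 0) (hYN (oddVec m (m - 1)))
        (hYN (oddVec m 0))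
      rwa [YY, hB1, one_smul] at h
    have hP0 : P u ⟨0, by omega⟩ = 0 := by
      rw [apply_lowest (by omega) hPT (fun j hj => absurd hj (by simp [Fin.lt_def])), hc]
      simp
    obtain ⟨w, hw⟩ := exists_shift_eq (by omega) hP0
    have hw1 : Y (P u) ∈ S.lowerCentralSeries N 1 := by
      rw [hw, ← Ye]
      exact mul_mem_lowerCentralSeries (k := 0) (hYN w) heN
    simp only [map_add, map_smul, LinearMap.add_apply, LinearMap.smul_apply, ex, fx, Yx, hd,
      zero_smul, zero_add, smul_zero, add_zero]
    exact add_mem (Submodule.smul_mem _ _ (Submodule.smul_mem _ _ hf1)) hw1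
  obtain ⟨γ, hγ⟩ : ∃ γ : ℂ, S.mul x e + S.mul e x = γ • f :=
    hann _ (add_mem (hle x e) (hle e x)) (hsq 0 e he)
  -- Parity does not exclude this defect. If `γ ≠ 0`, then `[x, γ f] = 0` gives `d = 0`, the
  -- identity for `x`, `e`, `x` gives `a γ = 0`, and `d = 2c + a(m - 1)` then contradicts `hnn`.
  have hγ0 : γ = 0 := by
    by_contra hne
    have h1 := hsq 0 e he x
    rw [hγ, map_smul, xf] at h1
    have hd : d = 0 := by
      have := hf0 (γ * d) (by rw [← neg_eq_zero, ← h1]; module)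
      exact (mul_eq_zero.1 this).resolve_left hne
    have hxe : S.mul x e = γ • f - (a • e + b • f) := by rw [← hγ, ex]; abel
    have h2 := hL 0 0 x e x he hx
    rw [s0, ex, xx, hxe, map_add, map_smul, map_smul, hxe, xf, map_sub, map_add, map_smul,
      map_smul, map_smul, LinearMap.sub_apply, LinearMap.add_apply, LinearMap.smul_apply,
      LinearMap.smul_apply, LinearMap.smul_apply, ex, fx, map_smul, LinearMap.smul_apply, fe,
      hd] at h2
    have h3 : (a * γ) • f = 0 := by
      have h4 := sub_eq_zero.2 h2
      rw [← h4]; module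
    have ha : a = 0 := (mul_eq_zero.1 (hf0 _ h3)).resolve_right hne
    refine hnn ⟨ha, ?_⟩
    have h4 := weight_eq (by omega) hPT hPB
    rw [hd, ha, zero_mul, add_zero] at h4
    simpa using h4.symm
  have xe : S.mul x e = -(a • e + b • f) := by
    rw [hγ0, zero_smul, ex] at hγ
    exact eq_neg_of_add_eq_zero_left hγ
  refine ⟨a, b, d, θ, P, ⟨⟨x, e, f, Y, hx, he, hf, hY, xx, ex, xe, fx, xf, Yx, xY, ee, ef, fe, ff,
    Ye, eY, Yf, fY, YY, fun ξ p q u h => ?_, hA⟩⟩, hPT, hPB, hθ, hnn⟩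
  have hξ : ξ = 0 := by
    by_contra hne
    refine hxN ?_
    have h1 : x = ξ⁻¹ • -(p • e + q • f + Y u) := by
      have : ξ • x = -(p • e + q • f + Y u) := by
        rw [eq_neg_iff_add_eq_zero, ← h]; abel
      rw [← this, smul_smul, inv_mul_cancel₀ hne, one_smul]
    rw [h1]
    exact N.smul_mem _ (N.neg_mem ((hmem _).2 ⟨p, q, u, rfl⟩))
  subst hξ
  exact ⟨rfl, hind p q u (by rw [← h]; module)⟩

end Superalgebra

/-! ### Normal forms of the odd action. -/

namespace NIdx

variable {m : ℕ}

/-- The diagonal action on the odd part for which `e₁` has weight `1` and `e₂` weight `d`. -/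
noncomputable def weightMap (m : ℕ) (d : ℂ) : (Fin m → ℂ) →ₗ[ℂ] (Fin m → ℂ) :=
  -- The constant solves `d = 2c + (m - 1)`, the relation of `weight_eq` for `a = 1`.
  ((d + 1 - m) / 2) • LinearMap.id + grade m

/-- The map `y_i ↦ y_i + ∑ b_{2k} y_{i+2k-1}`. -/
noncomputable def polyMap (m : ℕ) (b : Fin ((m - 1) / 2) → ℂ) :
    (Fin m → ℂ) →ₗ[ℂ] (Fin m → ℂ) :=
  LinearMap.id + ∑ k : Fin ((m - 1) / 2), b k • shift m ^ (2 * (k : ℕ) + 1)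

/-- The map `y_{i+1} ↦ p ^ i y_{i+1}`. -/
noncomputable def scaleMap (m : ℕ) (p : ℂ) : (Fin m → ℂ) →ₗ[ℂ] (Fin m → ℂ) :=
  LinearMap.pi fun i => p ^ (i : ℕ) • LinearMap.proj i

theorem scaleMap_oddVec (p : ℂ) (k : ℕ) : scaleMap m p (oddVec m k) = p ^ k • oddVec m k := by
  funext i
  simp only [scaleMap, LinearMap.pi_apply, LinearMap.smul_apply, LinearMap.proj_apply,
    Pi.smul_apply, oddVec_apply]
  split_ifs with h
  · rw [h]
  · simp

theorem weightMap_oddVec (d : ℂ) (k : ℕ) :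
    weightMap m d (oddVec m k) = ((d + 1 - m) / 2 + k) • oddVec m k := by
  simp [weightMap, grade_oddVec, add_smul]

theorem polyMap_oddVec (b : Fin ((m - 1) / 2) → ℂ) (k : ℕ) :
    polyMap m b (oddVec m k) = oddVec m k + ∑ j, b j • oddVec m (k + (2 * (j : ℕ) + 1)) := by
  simp [polyMap, shift_pow_oddVec]

theorem weightMap_shift (d : ℂ) (u : Fin m → ℂ) :
    weightMap m d (shift m u) = shift m (weightMap m d u) + (1 : ℂ) • shift m u := by
  simp only [weightMap, LinearMap.add_apply, LinearMap.smul_apply, LinearMap.id_apply, grade_shift,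
    map_add, map_smul]
  module

theorem oddForm_weightMap (d : ℂ) (u v : Fin m → ℂ) :
    oddForm m (weightMap m d u) v + oddForm m u (weightMap m d v) = d * oddForm m u v := by
  have := oddForm_grade u v
  simp only [weightMap, LinearMap.add_apply, LinearMap.smul_apply, LinearMap.id_apply,
    map_add, map_smul, smul_eq_mul]
  linear_combination this

theorem shift_pow_shift (n : ℕ) (u : Fin m → ℂ) :
    (shift m ^ n) (shift m u) = shift m ((shift m ^ n) u) := by
  rw [← Module.End.mul_apply, ← Module.End.mul_apply, ← pow_succ, ← pow_succ']

theorem polyMap_shift (b : Fin ((m - 1) / 2) → ℂ) (u : Fin m → ℂ) :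
    polyMap m b (shift m u) = shift m (polyMap m b u) + (0 : ℂ) • shift m u := by
  simp [polyMap, shift_pow_shift]

theorem oddForm_polyMap (b : Fin ((m - 1) / 2) → ℂ) (u v : Fin m → ℂ) :
    oddForm m (polyMap m b u) v + oddForm m u (polyMap m b v) = 2 * oddForm m u v := by
  have h : ∀ j : ℕ, oddForm m ((shift m ^ (2 * j + 1)) u) v =
      -oddForm m u ((shift m ^ (2 * j + 1)) v) := fun j => by
    rw [oddForm_shift_pow, Odd.neg_one_pow ⟨j, rfl⟩, neg_one_mul]
  simp only [polyMap, LinearMap.add_apply, LinearMap.sum_apply, LinearMap.smul_apply,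
    LinearMap.id_apply, map_add, map_sum, map_smul, smul_eq_mul, h, mul_neg,
    Finset.sum_neg_distrib]
  ring

theorem ext_of_shift {P Q : (Fin m → ℂ) →ₗ[ℂ] (Fin m → ℂ)}
    (hP : ∀ u, P (shift m u) = shift m (P u)) (hQ : ∀ u, Q (shift m u) = shift m (Q u))
    (h : P (oddVec m 0) = Q (oddVec m 0)) : P = Q := by
  rw [eq_sum_shift_pow hP, eq_sum_shift_pow hQ, h]

/-- A derivation of degree zero with `a = 0` is a multiple of some `polyMap`. -/
theorem exists_eq_polyMap (hodd : Odd m) {P : (Fin m → ℂ) →ₗ[ℂ] (Fin m → ℂ)} {d : ℂ}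
    (hPT : ∀ u, P (shift m u) = shift m (P u))
    (hPB : ∀ u v, oddForm m (P u) v + oddForm m u (P v) = d * oddForm m u v)
    (hc : P (oddVec m 0) ⟨0, hodd.pos⟩ ≠ 0) :
    ∃ b, P = P (oddVec m 0) ⟨0, hodd.pos⟩ • polyMap m b := by
  -- Even powers of the shift are self-adjoint, so pairing with the vector dual to `oddVec m j`
  -- gives twice the coefficient on one side and `0` on the other.
  have hev : ∀ j : Fin m, Even (j : ℕ) → (j : ℕ) ≠ 0 → P (oddVec m 0) j = 0 := by
    intro j hj hj0
    have h := hPB (oddVec m 0) (oddVec m (m - 1 - j))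
    rw [eq_sum_shift_pow hPT] at h
    set c := P (oddVec m 0)
    simp only [LinearMap.smul_apply, LinearMap.sum_apply, map_sum,
      map_smul, shift_pow_oddVec, oddForm_oddVec, smul_eq_mul] at h
    rw [Finset.sum_eq_single j, Finset.sum_eq_single j, if_pos (by omega), if_pos (by omega),
      if_neg (by omega)] at h
    · have e1 : Even (m - 1) := Nat.Odd.sub_odd hodd odd_one
      have e2 : Even (m - 1 - j) := (Nat.even_sub (by omega)).2 ⟨fun _ => hj, fun _ => e1⟩
      rw [show m - 1 - (j : ℕ) + j = m - 1 by omega, e1.neg_one_pow, e2.neg_one_pow] at h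
      linear_combination h / 2
    · intro b _ hb
      rw [if_neg, mul_zero]
      exact fun h => hb (Fin.ext (by omega))
    · simp
    · intro b _ hb
      rw [if_neg, mul_zero]
      exact fun h => hb (Fin.ext (by omega))
    · simp
  set c := P (oddVec m 0) ⟨0, hodd.pos⟩ with hcdef
  refine ⟨fun k => c⁻¹ * P (oddVec m 0) ⟨2 * k + 1, by omega⟩, ext_of_shift hPT (fun u => ?_) ?_⟩
  · rw [LinearMap.smul_apply, polyMap_shift, zero_smul, add_zero, LinearMap.smul_apply, map_smul]
  · funext i
    rw [LinearMap.smul_apply, polyMap_oddVec]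
    simp only [Pi.smul_apply, Pi.add_apply, Finset.sum_apply, oddVec_apply, smul_eq_mul, zero_add,
      mul_ite, mul_one, mul_zero]
    rcases Nat.even_or_odd (i : ℕ) with he | ho
    · rw [Finset.sum_eq_zero]
      · by_cases h0 : (i : ℕ) = 0
        · have hi : i = ⟨0, hodd.pos⟩ := Fin.ext h0
          rw [if_pos h0.symm, add_zero, mul_one, hcdef, hi]
        · rw [if_neg (Ne.symm h0), hev i he h0]; simp
      · intro k _
        rw [if_neg]
        intro h
        rw [← h] at he
        exact (Nat.not_even_iff_odd.2 ⟨k, rfl⟩) he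
    · obtain ⟨k, hk⟩ := ho
      obtain ⟨n, hn⟩ := hodd
      have hi : i = ⟨2 * k + 1, by omega⟩ := Fin.ext hk
      rw [Finset.sum_eq_single ⟨k, by omega⟩, if_pos hk.symm, if_neg (by omega), zero_add,
        ← mul_assoc, mul_inv_cancel₀ hc, one_mul]
      · exact congrArg _ hi
      · intro j _ hj
        rw [if_neg]
        exact fun h => hj (Fin.ext (by simp only; omega))
      · simp

/-- `P` has an eigenvector with leading term `y_1` when `a ≠ 0`. -/
theorem exists_eigenvector (hm : 0 < m) {P : (Fin m → ℂ) →ₗ[ℂ] (Fin m → ℂ)} {a : ℂ} (ha : a ≠ 0)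
    (hPT : ∀ u, P (shift m u) = shift m (P u) + a • shift m u) :
    ∃ v : Fin m → ℂ, v ⟨0, hm⟩ = 1 ∧ P v = P (oddVec m 0) ⟨0, hm⟩ • v := by
  set c := P (oddVec m 0) ⟨0, hm⟩ with hc
  -- `P - c` is triangular with diagonal `a i`, so nothing in its image has a `y_1` term.
  have hns : ¬ Function.Surjective (P - c • LinearMap.id : (Fin m → ℂ) →ₗ[ℂ] (Fin m → ℂ)) := by
    intro hs
    obtain ⟨w, hw⟩ := hs (oddVec m 0)
    have h1 := congrFun hw ⟨0, hm⟩
    have h2 := apply_lowest hm hPT (u := w) (i := ⟨0, hm⟩)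
      (fun j hj => absurd hj (by simp [Fin.lt_def]))
    simp [oddVec_apply, h2, ← hc] at h1
  have hni : ¬ Function.Injective (P - c • LinearMap.id : (Fin m → ℂ) →ₗ[ℂ] (Fin m → ℂ)) := fun h =>
    hns (LinearMap.surjective_of_injective h)
  obtain ⟨v, hv, hv0⟩ : ∃ v, (P - c • LinearMap.id : (Fin m → ℂ) →ₗ[ℂ] (Fin m → ℂ)) v = 0 ∧ v ≠ 0 := by
    by_contra! h
    exact hni ((injective_iff_map_eq_zero _).2 h)
  have hPv : P v = c • v := by
    rw [LinearMap.sub_apply, sub_eq_zero] at hv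
    exact hv
  obtain ⟨i, hi, hmin⟩ := wellFounded_lt.has_min {i | v i ≠ 0} (Function.ne_iff.1 hv0)
  have hlow := apply_lowest hm hPT (u := v) (i := i)
    (fun j hj => by_contra fun h => hmin j h hj)
  rw [hPv, Pi.smul_apply, smul_eq_mul, ← hc] at hlow
  -- Comparing leading coefficients gives `c = c + a i`, so the eigenvector starts at `y_1`.
  have h0 : a * i = 0 := by
    have := mul_right_cancel₀ hi hlow
    linear_combination -this
  have hi0 : (i : ℕ) = 0 := by
    simpa [ha] using h0
  have hi' : i = ⟨0, hm⟩ := Fin.ext hi0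
  subst hi'
  refine ⟨(v ⟨0, hm⟩)⁻¹ • v, inv_mul_cancel₀ hi, ?_⟩
  rw [map_smul, hPv, smul_comm]

theorem shift_pow_eigenvector {P : (Fin m → ℂ) →ₗ[ℂ] (Fin m → ℂ)} {a c : ℂ}
    (hPT : ∀ u, P (shift m u) = shift m (P u) + a • shift m u) {v : Fin m → ℂ}
    (hv : P v = c • v) (k : ℕ) :
    P ((shift m ^ k) v) = (c + a * k) • (shift m ^ k) v := by
  induction k with
  | zero => simp [hv]
  | succ k ih =>
    rw [pow_succ', Module.End.mul_apply, hPT, ih, map_smul]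
    push_cast
    module

/-- The form is determined on the translates of an eigenvector. -/
theorem oddForm_eigenvector (hodd : Odd m) {P : (Fin m → ℂ) →ₗ[ℂ] (Fin m → ℂ)} {a c d : ℂ}
    (ha : a ≠ 0) (hd : d = 2 * c + a * (m - 1))
    (hPT : ∀ u, P (shift m u) = shift m (P u) + a • shift m u)
    (hPB : ∀ u v, oddForm m (P u) v + oddForm m u (P v) = d * oddForm m u v)
    {v : Fin m → ℂ} (hv : P v = c • v) (hv0 : v ⟨0, hodd.pos⟩ = 1) (i j : ℕ) :
    oddForm m ((shift m ^ i) v) ((shift m ^ j) v) = if i + j + 1 = m then (-1) ^ j else 0 := by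
  split_ifs with h
  -- A total shift by `m - 1` leaves only the leading term of `v`, which is `1`.
  · have h1 : (shift m ^ (i + j)) v = oddVec m (m - 1) := by
      funext k
      rw [shift_pow_apply, oddVec_apply]
      by_cases hk : m - 1 = k
      · rw [if_pos hk, dif_pos (by omega), ← hv0]
        congr 1
        exact Fin.ext (by simp only; omega)
      · rw [if_neg hk, dif_neg (by omega)]
    have e1 : Even (m - 1) := Nat.Odd.sub_odd hodd odd_one
    rw [oddForm_symm hodd, oddForm_shift_pow, ← Module.End.mul_apply, ← pow_add, add_comm j i, h1,
      ← sum_smul_oddVec v]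
    simp only [map_sum, map_smul, LinearMap.sum_apply, LinearMap.smul_apply, oddForm_oddVec,
      smul_eq_mul]
    rw [Finset.sum_eq_single ⟨0, hodd.pos⟩, hv0, if_pos (by simp only; have := hodd.pos; omega),
      e1.neg_one_pow]
    · ring
    · intro b _ hb
      rw [if_neg, mul_zero]
      exact fun h => hb (Fin.ext (by simp only; omega))
    · simp
  -- The translates have weights `c + a i` and `c + a j`; a nonzero pairing forces their sum to be
  -- `d`.
  · have h1 := hPB ((shift m ^ i) v) ((shift m ^ j) v)
    rw [shift_pow_eigenvector hPT hv, shift_pow_eigenvector hPT hv, map_smul, map_smul,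
      LinearMap.smul_apply, smul_eq_mul, smul_eq_mul, hd] at h1
    have h2 : (a * ((i + j + 1 : ℕ) - (m : ℕ) : ℂ)) *
        oddForm m ((shift m ^ i) v) ((shift m ^ j) v) = 0 := by
      push_cast
      linear_combination h1
    refine (mul_eq_zero.1 h2).resolve_left (mul_ne_zero ha (sub_ne_zero.2 ?_))
    exact_mod_cast h

end NIdx

/-! ### Normalisation and comparison of frames. -/

namespace Superalgebra
namespace Frame

variable {A : Type*} [AddCommGroup A] [Module ℂ A] {m : ℕ} {S : Superalgebra A} {a b d θ : ℂ}
  {P : (Fin m → ℂ) →ₗ[ℂ] (Fin m → ℂ)}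

/-- Diagonalisation of the action of `x` on the odd part. -/
theorem exists_weightMap (F : Frame m S a b d θ P) (hodd : Odd m) (ha : a ≠ 0)
    (hPT : ∀ u, P (shift m u) = shift m (P u) + a • shift m u)
    (hPB : ∀ u v, oddForm m (P u) v + oddForm m u (P v) = d * oddForm m u v)
    {b' θ' q ρ : ℂ} (hρ : ρ ≠ 0) (hb : a⁻¹ * (b + q * d) = q + b' * (ρ * ρ))
    (hθ : a⁻¹ * a⁻¹ * θ = θ' * (ρ * ρ)) :
    Nonempty (Frame m S 1 b' (a⁻¹ * d) θ' (weightMap m (a⁻¹ * d))) := by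
  obtain ⟨v, hv0, hv⟩ := exists_eigenvector hodd.pos ha hPT
  have hd := weight_eq hodd.pos hPT hPB
  -- As a polynomial in the shift, `G` commutes with it and sends `y_{k+1}` to `ρ` times the `k`-th
  -- translate of `v`. The form is quadratic, so `f` scales by `ρ * ρ`.
  let G : (Fin m → ℂ) →ₗ[ℂ] (Fin m → ℂ) := ∑ j : Fin m, (ρ * v j) • shift m ^ (j : ℕ)
  have hGv : ∀ k, G (oddVec m k) = ρ • (shift m ^ k) v := by
    intro k
    conv_rhs => rw [← sum_smul_oddVec v]
    simp only [G, LinearMap.sum_apply, LinearMap.smul_apply, map_sum, map_smul, shift_pow_oddVec,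
      Finset.smul_sum, smul_smul]
    exact Finset.sum_congr rfl fun j _ => by rw [add_comm]
  refine F.change a⁻¹ 0 1 q (ρ * ρ) G (inv_ne_zero ha) one_ne_zero (mul_ne_zero hρ hρ)
    (fun u => ?_) (fun u w => ?_) (fun u => ?_) (inv_mul_cancel₀ ha) (by rw [one_mul, one_mul, hb])
    rfl hθ
  · simp only [G, LinearMap.sum_apply, LinearMap.smul_apply, shift_pow_shift, map_sum, map_smul,
      one_smul]
  · have : (oddForm m).compl₁₂ G G = (ρ * ρ) • oddForm m := oddForm_ext fun i j => by
      simp only [LinearMap.compl₁₂_apply, LinearMap.smul_apply, hGv, map_smul,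
        oddForm_eigenvector hodd ha hd hPT hPB hv hv0, oddForm_oddVec, smul_eq_mul, mul_assoc]
    exact LinearMap.congr_fun₂ this u w
  · rw [zero_smul, add_zero]
    refine LinearMap.congr_fun (f := G ∘ₗ weightMap m (a⁻¹ * d)) (g := a⁻¹ • (P ∘ₗ G))
      (oddVec_ext fun k _ => ?_) u
    simp only [LinearMap.comp_apply, LinearMap.smul_apply, weightMap_oddVec, map_smul, hGv,
      shift_pow_eigenvector hPT hv, smul_smul]
    congr 1
    rw [hd]
    field_simp
    ring

/-- Two frames of the same superalgebra are related by a change of frame. -/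
theorem compare {a' b' d' θ' : ℂ} {P' : (Fin m → ℂ) →ₗ[ℂ] (Fin m → ℂ)}
    (F : Frame m S a b d θ P) (F' : Frame m S a' b' d' θ' P') (hm : 0 < m) {v : A} {μ : ℂ}
    (hv : v ≠ 0) (hμ : μ ≠ 0) (hvx : S.mul v F'.x = μ • v) (hve : S.mul v F'.e = 0)
    (hvf : S.mul v F'.f = 0) :
    ∃ (l s p q r : ℂ) (G : (Fin m → ℂ) →ₗ[ℂ] (Fin m → ℂ)), l ≠ 0 ∧ p ≠ 0 ∧ r ≠ 0 ∧
      Function.Surjective G ∧ (∀ u, G (shift m u) = p • shift m (G u)) ∧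
      (∀ u, G (P u) = l • P' (G u) + s • shift m (G u)) ∧ l * a' = a ∧
      l * (p * b' + q * d') = a * q + b * r ∧ l * d' = d ∧ l * l * θ' = θ * r := by
  obtain ⟨ν, p, q, he⟩ := F'.exists_of_mem_even F.e_mem
  obtain ⟨l, s, t, hx⟩ := F'.exists_of_mem_even F.x_mem
  -- Otherwise `v` is an eigenvector of right multiplication by `F.e` with nonzero eigenvalue, but
  -- in the coordinates of `F` that operator is nilpotent.
  have hν : ν = 0 := by
    by_contra hν
    have h1 : S.mul v F.e = (ν * μ) • v := by
      rw [he, map_add, map_add, map_smul, map_smul, map_smul, hvx, hve, hvf]; module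
    refine hv ?_
    obtain ⟨ξ, p, q, u, rfl⟩ := F.exists_coords v
    have h2 : F.e = (0 : ℂ) • F.x + (1 : ℂ) • F.e + (0 : ℂ) • F.f + F.Y 0 := by simp
    replace h1 : S.mul (ξ • F.x + p • F.e + q • F.f + F.Y u)
        ((0 : ℂ) • F.x + (1 : ℂ) • F.e + (0 : ℂ) • F.f + F.Y 0) =
        (ν * μ) • (ξ • F.x + p • F.e + q • F.f + F.Y u) := by rw [← h2]; exact h1
    rw [F.mul_lin] at h1
    have h3 : (ν * μ) • (ξ • F.x + p • F.e + q • F.f + F.Y u) = (ν * μ * ξ) • F.x +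
        (ν * μ * p) • F.e + (ν * μ * q) • F.f + F.Y ((ν * μ) • u) := by
      rw [map_smul]; module
    rw [h3] at h1
    obtain ⟨k1, k2, k3, k4⟩ := F.coords_inj h1
    have hνμ := mul_ne_zero hν hμ
    have hξ : ξ = 0 := (mul_eq_zero.1 k1.symm).resolve_left hνμ
    subst hξ
    have hp : p = 0 := (mul_eq_zero.1 (k2.symm.trans (by ring))).resolve_left hνμ
    have hq : q = 0 := (mul_eq_zero.1 (k3.symm.trans (by simp [hp]))).resolve_left hνμ
    have hu : u = 0 := eq_zero_of_shift_eq_smul hνμ (by simpa using k4)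
    simp [hp, hq, hu]
  rw [hν, zero_smul, zero_add] at he
  let G : (Fin m → ℂ) →ₗ[ℂ] (Fin m → ℂ) :=
    LinearMap.snd ℂ ℂ (Fin m → ℂ) ∘ₗ LinearMap.snd ℂ ℂ (ℂ × (Fin m → ℂ)) ∘ₗ
      LinearMap.snd ℂ ℂ (ℂ × ℂ × (Fin m → ℂ)) ∘ₗ F'.equiv.symm.toLinearMap ∘ₗ F.Y
  have hY : ∀ u, F.Y u = F'.Y (G u) := by
    intro u
    obtain ⟨w, hw⟩ := F'.exists_of_mem_odd (F.Y_mem u)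
    have h1 : F'.Y w = F'.equiv (0, 0, 0, w) := by simp [equiv_apply]
    have h2 : G u = w := by
      change (F'.equiv.symm (F.Y u)).2.2.2 = w
      rw [hw, h1, LinearEquiv.symm_apply_apply]
    rw [h2, hw]
  have hYinj : ∀ u w, F'.Y u = F'.Y w → u = w := fun u w h => by
    have := F'.coords_inj (ξ := 0) (p := 0) (q := 0) (ξ' := 0) (p' := 0) (q' := 0) (u := u)
      (u' := w) (by rw [h])
    exact this.2.2.2
  have hGs : Function.Surjective G := LinearMap.surjective_of_injective
    ((injective_iff_map_eq_zero _).2 fun u hu => by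
      refine (F.indep 0 0 0 u ?_).2.2.2
      rw [hY, hu, map_zero]; simp)
  -- `F.f` is a product of two odd elements, and all such products are multiples of `F'.f`.
  obtain ⟨r, hf⟩ : ∃ r : ℂ, F.f = r • F'.f := by
    have h := F.YY (oddVec m (m - 1)) (oddVec m 0)
    rw [oddForm_oddVec, if_pos (by omega), pow_zero, one_smul, hY, hY, F'.YY] at h
    exact ⟨_, h.symm⟩
  have hr : r ≠ 0 := by
    rintro rfl
    have := F.indep 0 0 1 0 (by rw [hf]; simp)
    exact one_ne_zero this.2.2.1
  have hp : p ≠ 0 := by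
    rintro rfl
    have := F.indep 0 r (-q) 0 (by rw [he, hf, map_zero]; module)
    exact hr this.2.1
  have hl : l ≠ 0 := by
    rintro rfl
    -- If `l = 0`, all of `F.x`, `F.e`, `F.f` lie in the plane of `F'.e` and `F'.f`; these
    -- coefficients are their linear relation.
    have := F.indep (p * r) (-s * r) (s * q - p * t) 0 (by rw [hx, he, hf, map_zero]; module)
    exact mul_ne_zero hp hr this.1
  have hex : a • F.e + b • F.f = (l * (p * a')) • F'.e + (l * (p * b' + q * d')) • F'.f := by
    rw [← F.ex, he, hx]
    simp only [map_add, map_smul, LinearMap.add_apply, LinearMap.smul_apply, F'.ex, F'.fx, F'.ee,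
      F'.ef, F'.fe, F'.ff]
    module
  have hfx : d • F.f = (l * r * d') • F'.f := by
    rw [← F.fx, hf, hx]
    simp only [map_add, map_smul, LinearMap.smul_apply, F'.fx, F'.fe, F'.ff]
    module
  have hxx : θ • F.f = (l * l * θ') • F'.f := by
    rw [← F.xx, hx]
    simp only [map_add, map_smul, LinearMap.add_apply, LinearMap.smul_apply, F'.xx, F'.ex, F'.xe,
      F'.fx, F'.xf, F'.ee, F'.ef, F'.fe, F'.ff]
    module
  have hf0 : ∀ c c' : ℂ, c • F'.f = c' • F'.f → c = c' := fun c c' h => by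
    have := F'.coords_inj (ξ := 0) (p := 0) (q := c) (ξ' := 0) (p' := 0) (q' := c') (u := 0)
      (u' := 0) (by rw [h])
    exact this.2.2.1
  obtain ⟨-, k1, k2, -⟩ := F'.coords_inj (ξ := 0) (p := a * p) (q := a * q + b * r) (ξ' := 0)
    (p' := l * (p * a')) (q' := l * (p * b' + q * d')) (u := 0) (u' := 0) (by
      have h : a • F.e + b • F.f = (a * p) • F'.e + (a * q + b * r) • F'.f := by
        rw [he, hf]; module
      rw [h] at hex
      simp only [zero_smul, zero_add, hex])
  refine ⟨l, s, p, q, r, G, hl, hp, hr, hGs, fun u => hYinj _ _ ?_, fun u => hYinj _ _ ?_, ?_,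
    k2.symm, ?_, ?_⟩
  · rw [← hY, ← F.Ye, hY, he, map_add, map_smul, map_smul, F'.Ye, F'.Yf, map_smul]; simp
  · rw [← hY, ← F.Yx, hY, hx, map_add, map_add, map_smul, map_smul, map_smul, F'.Yx, F'.Ye, F'.Yf,
      map_add, map_smul, map_smul]
    simp
  · exact mul_right_cancel₀ hp (by linear_combination -k1)
  · rw [hf, smul_smul] at hfx
    exact mul_right_cancel₀ hr (by linear_combination -hf0 _ _ hfx)
  · rw [hf, smul_smul] at hxx
    exact (hf0 _ _ hxx).symm

theorem mul_last_x (F : Frame m S a b d θ (weightMap m d)) (hm : 0 < m) :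
    S.mul (F.Y (oddVec m (m - 1))) F.x = ((d + m - 1) / 2) • F.Y (oddVec m (m - 1)) := by
  rw [F.Yx, weightMap_oddVec, map_smul, Nat.cast_sub hm]
  congr 1
  push_cast
  ring

theorem Y_last_ne_zero (F : Frame m S a b d θ P) (hm : 0 < m) : F.Y (oddVec m (m - 1)) ≠ 0 := by
  intro h
  have := (F.indep 0 0 0 _ (by rw [h]; simp)).2.2.2
  have h1 := congrFun this ⟨m - 1, by omega⟩
  simp [oddVec_apply] at h1

theorem f_ne_zero (F : Frame m S a b d θ P) : F.f ≠ 0 := fun h =>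
  one_ne_zero (F.indep 0 0 1 0 (by rw [h]; simp)).2.2.1

/-- `x` acts with a nonzero weight on an element annihilated by `e` and `f`. -/
theorem exists_weight (F : Frame m S 1 b d θ (weightMap m d)) (hm : 3 ≤ m) :
    ∃ (v : A) (μ : ℂ), v ≠ 0 ∧ μ ≠ 0 ∧ S.mul v F.x = μ • v ∧ S.mul v F.e = 0 ∧
      S.mul v F.f = 0 := by
  -- `f` has weight `d`; when that vanishes, the last odd vector has weight `(m - 1) / 2 ≠ 0`.
  by_cases hd : d = 0
  · subst hd
    refine ⟨_, _, F.Y_last_ne_zero (by omega), ?_, F.mul_last_x (by omega), ?_, F.Yf _⟩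
    · have h : ((0 : ℂ) + m - 1) / 2 = ((m - 1 : ℕ) : ℂ) / 2 := by
        rw [Nat.cast_sub (by omega)]; simp
      rw [h]
      have : ((m - 1 : ℕ) : ℂ) ≠ 0 := Nat.cast_ne_zero.2 (by omega)
      exact div_ne_zero this two_ne_zero
    · rw [F.Ye, shift_oddVec, oddVec_of_le (by omega), map_zero]
  · exact ⟨F.f, d, F.f_ne_zero, hd, F.fx, F.fe, F.ff⟩

end Frame
end Superalgebra

/-! ### The four families: membership, classification and isomorphisms. -/

section Families

open Superalgebra

variable {m : ℕ}

theorem superM₁_frame (m : ℕ) : Nonempty (Frame m (superM₁ m) 1 0 0 1 (weightMap m 0)) := by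
  refine superExt_frame _ _ ?_ ?_ (fun k => ?_) ?_
  · simp [D₁]
  · simp [D₁]
  · rw [weightMap_oddVec, oddVec_coe, ← Pi.single_smul, oddIncl_single]
    simp only [D₁, smul_eq_mul, mul_one]
    congr 1
    ring
  · simp

theorem superM₂_frame (m : ℕ) (α : ℂ) :
    Nonempty (Frame m (superM₂ m α) 1 0 α 0 (weightMap m α)) := by
  refine superExt_frame _ _ ?_ ?_ (fun k => ?_) ?_
  · simp [D₂]
  · rw [D₂, ← Pi.single_smul, smul_eq_mul, mul_one]
  · rw [weightMap_oddVec, oddVec_coe, ← Pi.single_smul, oddIncl_single]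
    simp only [D₂, smul_eq_mul, mul_one]
    congr 1
    ring
  · simp

theorem superM₃_frame (m : ℕ) : Nonempty (Frame m (superM₃ m) 1 1 1 0 (weightMap m 1)) := by
  refine superExt_frame _ _ ?_ ?_ (fun k => ?_) ?_
  · simp [D₃]
  · simp [D₃]
  · rw [weightMap_oddVec, oddVec_coe, ← Pi.single_smul, oddIncl_single]
    simp only [D₃, smul_eq_mul, mul_one]
    congr 1
    ring
  · simp

theorem superM₄_frame (m : ℕ) (b : Fin ((m - 1) / 2) → ℂ) :
    Nonempty (Frame m (superM₄ m b) 0 0 2 0 (polyMap m b)) := by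
  refine superExt_frame _ _ ?_ ?_ (fun k => ?_) ?_
  · simp [D₄]
  · rw [D₄, ← Pi.single_smul, smul_eq_mul, mul_one]
  · rw [polyMap_oddVec, map_add, map_sum, oddVec_coe, oddIncl_single]
    simp only [D₄, map_smul, oddIncl_oddVec, add_assoc]
  · simp

theorem isSolvableExtension_of_weightMap {A : Type*} [AddCommGroup A] [Module ℂ A]
    {S : Superalgebra A} {b d θ : ℂ} (F : Frame m S 1 b d θ (weightMap m d)) (hodd : Odd m)
    (hm : 3 ≤ m) (hθ : θ * d = 0) : IsSolvableExtensionOfN m S := by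
  obtain ⟨v, μ, hv, hμ, hvx, -, -⟩ := F.exists_weight hm
  exact F.isSolvableExtension hodd (weightMap_shift d) (oddForm_weightMap d) hθ hv hμ hvx

theorem superM₄_isSolvableExtension (hodd : Odd m) (b : Fin ((m - 1) / 2) → ℂ) :
    IsSolvableExtensionOfN m (superM₄ m b) := by
  obtain ⟨F⟩ := superM₄_frame m b
  exact F.isSolvableExtension hodd (polyMap_shift b) (oddForm_polyMap b) (zero_mul _) F.f_ne_zero
    two_ne_zero F.fx

theorem superM_classification {A : Type*} [AddCommGroup A] [Module ℂ A] {S : Superalgebra A}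
    (hodd : Odd m) (hm : 3 ≤ m) (h : IsSolvableExtensionOfN m S) :
    S.Iso (superM₁ m) ∨ (∃ α : ℂ, S.Iso (superM₂ m α)) ∨ S.Iso (superM₃ m) ∨
      ∃ b : Fin ((m - 1) / 2) → ℂ, S.Iso (superM₄ m b) := by
  obtain ⟨a, b, d, θ, P, ⟨F⟩, hPT, hPB, hθ, hnn⟩ := exists_frame hodd hm h
  by_cases ha : a = 0
  · subst ha
    have hc : P (oddVec m 0) ⟨0, hodd.pos⟩ ≠ 0 := fun h => hnn ⟨rfl, h⟩
    have hd := weight_eq hodd.pos hPT hPB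
    obtain ⟨b', hP⟩ := exists_eq_polyMap hodd (fun u => by rw [hPT, zero_smul, add_zero]) hPB hc
    set c := P (oddVec m 0) ⟨0, hodd.pos⟩
    rw [zero_mul, add_zero] at hd
    have hd0 : d ≠ 0 := by rw [hd]; exact mul_ne_zero two_ne_zero hc
    have hθ0 : θ = 0 := (mul_eq_zero.1 hθ).resolve_right hd0
    obtain ⟨F'⟩ := F.change (a' := 0) (b' := 0) (d' := 2) (θ' := 0) (P' := polyMap m b') c⁻¹ 0 1
      -- Here `e` has weight `0` and `f` weight `d = 2c ≠ 0`, so this multiple of `f` removes `b`.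
      (-b / d) 1 LinearMap.id (inv_ne_zero hc) one_ne_zero one_ne_zero (fun u => by simp)
      (fun u v => by simp) (fun u => by
        rw [LinearMap.id_apply, LinearMap.id_apply, hP, LinearMap.smul_apply, smul_smul,
          inv_mul_cancel₀ hc]
        simp) (by simp) (by field_simp; ring) (by rw [hd]; field_simp) (by simp [hθ0])
    obtain ⟨G⟩ := superM₄_frame m b'
    exact Or.inr (Or.inr (Or.inr ⟨b', F'.iso G⟩))
  · by_cases hd1 : d = a
    · have hθ0 : θ = 0 := (mul_eq_zero.1 hθ).resolve_right (hd1 ▸ ha)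
      have hd' : a⁻¹ * d = 1 := by rw [hd1, inv_mul_cancel₀ ha]
      by_cases hb : b = 0
      · obtain ⟨F'⟩ := F.exists_weightMap hodd ha hPT hPB (b' := 0) (θ' := 0) (q := 0) (ρ := 1)
          one_ne_zero (by simp [hb]) (by simp [hθ0])
        rw [hd'] at F'
        obtain ⟨G⟩ := superM₂_frame m 1
        exact Or.inr (Or.inl ⟨1, F'.iso G⟩)
      -- For `d = a` adding a multiple of `f` to `e` leaves `b` unchanged; it can only be rescaled,
      -- here to `1`.
      · obtain ⟨ρ, hρ⟩ := IsAlgClosed.exists_pow_nat_eq (a⁻¹ * b) (n := 2) two_pos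
        have hρ0 : ρ ≠ 0 := by
          rintro rfl
          rw [zero_pow two_ne_zero] at hρ
          exact mul_ne_zero (inv_ne_zero ha) hb hρ.symm
        obtain ⟨F'⟩ := F.exists_weightMap hodd ha hPT hPB (b' := 1) (θ' := 0) (q := 0) hρ0
          (by rw [← pow_two, hρ]; ring) (by simp [hθ0])
        rw [hd'] at F'
        obtain ⟨G⟩ := superM₃_frame m
        exact Or.inr (Or.inr (Or.inl (F'.iso G)))
    · have had : a - d ≠ 0 := sub_ne_zero.2 (Ne.symm hd1)
      -- For `d ≠ a` the vector `e + q f` with `q = b / (a - d)` is an eigenvector of weight `a`.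
      have hq : a⁻¹ * (b + b / (a - d) * d) = b / (a - d) := by
        field_simp; ring
      by_cases hθ0 : θ = 0
      · obtain ⟨F'⟩ := F.exists_weightMap hodd ha hPT hPB (b' := 0) (θ' := 0) (q := b / (a - d))
          (ρ := 1) one_ne_zero (by rw [hq]; ring) (by simp [hθ0])
        obtain ⟨G⟩ := superM₂_frame m (a⁻¹ * d)
        exact Or.inr (Or.inl ⟨_, F'.iso G⟩)
      · have hd0 : d = 0 := (mul_eq_zero.1 hθ).resolve_left hθ0
        obtain ⟨ρ, hρ⟩ := IsAlgClosed.exists_pow_nat_eq (a⁻¹ * a⁻¹ * θ) (n := 2) two_pos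
        have hρ0 : ρ ≠ 0 := by
          rintro rfl
          rw [zero_pow two_ne_zero] at hρ
          exact mul_ne_zero (mul_ne_zero (inv_ne_zero ha) (inv_ne_zero ha)) hθ0 hρ.symm
        obtain ⟨F'⟩ := F.exists_weightMap hodd ha hPT hPB (b' := 0) (θ' := 1) (q := b / (a - d))
          hρ0 (by rw [hq]; ring) (by rw [one_mul, ← pow_two ρ, hρ])
        rw [hd0, mul_zero] at F'
        obtain ⟨G⟩ := superM₁_frame m
        exact Or.inl (F'.iso G)

/-- Invariants of an isomorphism onto an extension in which `e` has weight `1`. -/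
theorem iso_weightMap {A B : Type*} [AddCommGroup A] [Module ℂ A] [AddCommGroup B] [Module ℂ B]
    {S : Superalgebra A} {T : Superalgebra B} {b d θ b' d' θ' : ℂ} (hm : 3 ≤ m)
    (F : Frame m S 1 b d θ (weightMap m d)) (F' : Frame m T 1 b' d' θ' (weightMap m d'))
    (h : S.Iso T) : d = d' ∧ ∃ p q r : ℂ, p ≠ 0 ∧ r ≠ 0 ∧ p * b' + q * d = q + b * r ∧
      θ' = θ * r := by
  obtain ⟨K⟩ := F.map h
  obtain ⟨v, μ, hv, hμ, hvx, hve, hvf⟩ := F'.exists_weight hm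
  obtain ⟨l, s, p, q, r, G, -, hp, hr, -, -, -, h1, h2, h3, h4⟩ :=
    K.compare F' (by omega) hv hμ hvx hve hvf
  rw [mul_one] at h1
  subst h1
  rw [one_mul] at h3
  subst h3
  exact ⟨rfl, p, q, r, hp, hr, by simpa using h2, by simpa using h4⟩

theorem not_iso_superM₄ {A : Type*} [AddCommGroup A] [Module ℂ A] {S : Superalgebra A}
    {b d θ : ℂ} (hm : 0 < m) (F : Frame m S 1 b d θ (weightMap m d))
    (b' : Fin ((m - 1) / 2) → ℂ) : ¬ S.Iso (superM₄ m b') := by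
  intro h
  obtain ⟨K⟩ := F.map h
  obtain ⟨F'⟩ := superM₄_frame m b'
  obtain ⟨l, s, p, q, r, G, -, -, -, -, -, -, h1, -⟩ :=
    K.compare F' hm F'.f_ne_zero two_ne_zero F'.fx F'.fe F'.ff
  simp at h1

theorem superM₄_params_of_iso (hm : 0 < m) {b b' : Fin ((m - 1) / 2) → ℂ}
    (h : (superM₄ m b).Iso (superM₄ m b')) :
    ∃ r : ℂ, r ≠ 0 ∧ ∀ k : Fin ((m - 1) / 2), (k : ℕ) ≠ 0 →
      b' k = r ^ (2 * (k : ℕ) + 1) * b k := by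
  obtain ⟨F⟩ := superM₄_frame m b
  obtain ⟨K⟩ := F.map h
  obtain ⟨F'⟩ := superM₄_frame m b'
  obtain ⟨l, s, p, q, r, G, -, hp, -, hGs, hGT, hGP, -, -, h3, -⟩ :=
    K.compare F' hm F'.f_ne_zero two_ne_zero F'.fx F'.fe F'.ff
  have hl : l = 1 := by linear_combination h3 / 2
  subst hl
  have hGn : ∀ n u, G ((shift m ^ n) u) = p ^ n • (shift m ^ n) (G u) := by
    intro n u
    induction n with
    | zero => simp
    | succ n ih =>
      rw [pow_succ', Module.End.mul_apply, hGT, ih, map_smul, smul_smul, ← pow_succ',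
        ← Module.End.mul_apply, ← pow_succ']
  refine ⟨p, hp, fun k hk => ?_⟩
  -- Evaluating at a preimage of `y_1` lets the coefficients be compared without knowing `G`; the
  -- term with `s` meets only the coefficient of `k = 0`.
  obtain ⟨u, hu⟩ := hGs (oddVec m 0)
  have h1 := congrFun (hGP u) ⟨2 * k + 1, by omega⟩
  simp only [polyMap, LinearMap.add_apply, LinearMap.sum_apply, LinearMap.smul_apply,
    LinearMap.id_apply, map_add, map_sum, map_smul, hGn, hu, one_smul, shift_oddVec,
    shift_pow_oddVec, Pi.add_apply, Finset.sum_apply, Pi.smul_apply, oddVec_apply, smul_eq_mul,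
    zero_add] at h1
  rw [Finset.sum_eq_single k, Finset.sum_eq_single k, if_pos rfl, if_neg (by omega),
    if_neg (by omega)] at h1
  · linear_combination -h1
  · intro j _ hj
    rw [if_neg, mul_zero]
    exact fun h => hj (Fin.ext (by omega))
  · simp
  · intro j _ hj
    rw [if_neg, mul_zero, mul_zero]
    exact fun h => hj (Fin.ext (by omega))
  · simp

theorem superM₄_iso_of_params (hm : 3 ≤ m) {b b' : Fin ((m - 1) / 2) → ℂ} {r : ℂ} (hr : r ≠ 0)
    (h : ∀ k : Fin ((m - 1) / 2), (k : ℕ) ≠ 0 → b' k = r ^ (2 * (k : ℕ) + 1) * b k) :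
    (superM₄ m b).Iso (superM₄ m b') := by
  obtain ⟨F⟩ := superM₄_frame m b
  obtain ⟨F'⟩ := superM₄_frame m b'
  let k₀ : Fin ((m - 1) / 2) := ⟨0, by omega⟩
  have hr' := inv_ne_zero hr
  suffices hK : Nonempty (Frame m (superM₄ m b) 0 0 2 0 (polyMap m b')) by
    obtain ⟨K⟩ := hK
    exact K.iso F'
  -- Scaling `e` by `r⁻¹` scales `f` by `r⁻¹ ^ (m - 1)`, since paired indices add up to `m - 1`. The
  -- multiple of `e` added to `x` adjusts the first-order coefficient, which is why `b₂` is free.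
  refine F.change 1 (b' k₀ * r⁻¹ - b k₀) r⁻¹ 0 (r⁻¹ ^ (m - 1)) (scaleMap m r⁻¹) one_ne_zero hr'
    (pow_ne_zero _ hr') ?_ ?_ ?_ (by simp) (by simp) (by simp) (by simp)
  · intro u
    refine LinearMap.congr_fun (f := scaleMap m r⁻¹ ∘ₗ shift m)
      (g := r⁻¹ • (shift m ∘ₗ scaleMap m r⁻¹)) (oddVec_ext fun k _ => ?_) u
    simp only [LinearMap.comp_apply, LinearMap.smul_apply, shift_oddVec, scaleMap_oddVec, map_smul,
      smul_smul, pow_succ']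
  · intro u v
    refine LinearMap.congr_fun₂ (f := (oddForm m).compl₁₂ (scaleMap m r⁻¹) (scaleMap m r⁻¹))
      (g := r⁻¹ ^ (m - 1) • oddForm m) (oddForm_ext fun i j => ?_) u v
    simp only [LinearMap.compl₁₂_apply, LinearMap.smul_apply, scaleMap_oddVec, map_smul,
      oddForm_oddVec, smul_eq_mul]
    split_ifs with hij
    · rw [← mul_assoc, ← pow_add, show m - 1 = j + i by omega]
    · simp
  · intro u
    refine LinearMap.congr_fun (f := scaleMap m r⁻¹ ∘ₗ polyMap m b')
      (g := (1 : ℂ) • (polyMap m b ∘ₗ scaleMap m r⁻¹) +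
        (b' k₀ * r⁻¹ - b k₀) • (shift m ∘ₗ scaleMap m r⁻¹)) (oddVec_ext fun n _ => ?_) u
    simp only [LinearMap.comp_apply, LinearMap.smul_apply, LinearMap.add_apply, polyMap_oddVec,
      scaleMap_oddVec, map_add, map_sum, map_smul, shift_oddVec, one_smul, smul_add,
      Finset.smul_sum, smul_smul, add_assoc]
    congr 1
    rw [Fintype.sum_eq_add_sum_compl k₀, Fintype.sum_eq_add_sum_compl k₀, add_right_comm]
    congr 1
    · simp only [k₀, mul_zero, zero_add]
      rw [← add_smul]
      congr 1
      ring
    · refine Finset.sum_congr rfl fun j hj => ?_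
      have hj0 : (j : ℕ) ≠ 0 := fun h0 => by
        rw [Finset.mem_compl, Finset.mem_singleton] at hj
        exact hj (Fin.ext h0)
      rw [h j hj0]
      congr 1
      have e : r ^ (2 * (j : ℕ) + 1) * r⁻¹ ^ (2 * (j : ℕ) + 1) = 1 := by
        rw [← mul_pow, mul_inv_cancel₀ hr, one_pow]
      rw [pow_add r⁻¹ n]
      linear_combination (r⁻¹ ^ n * b j) * e

end Families

end Classification

theorem mainTheorem6 (m : ℕ) (hodd : Odd m) (hm : 3 ≤ m) :
    -- every such superalgebra is isomorphic to a member of the list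
    (∀ {L : Type*} [AddCommGroup L] [Module ℂ L] (S : Superalgebra L),
      IsSolvableExtensionOfN m S →
        S.Iso (superM₁ m) ∨ (∃ α : ℂ, S.Iso (superM₂ m α)) ∨ S.Iso (superM₃ m) ∨
          ∃ b : Fin ((m - 1) / 2) → ℂ, S.Iso (superM₄ m b)) ∧
    -- every member of the list is such a superalgebra
    IsSolvableExtensionOfN m (superM₁ m) ∧
    (∀ α : ℂ, IsSolvableExtensionOfN m (superM₂ m α)) ∧
    IsSolvableExtensionOfN m (superM₃ m) ∧
    (∀ b : Fin ((m - 1) / 2) → ℂ, IsSolvableExtensionOfN m (superM₄ m b)) ∧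
    -- no two members of different families are isomorphic
    (∀ α : ℂ, ¬ (superM₁ m).Iso (superM₂ m α)) ∧
    ¬ (superM₁ m).Iso (superM₃ m) ∧
    (∀ b : Fin ((m - 1) / 2) → ℂ, ¬ (superM₁ m).Iso (superM₄ m b)) ∧
    (∀ α : ℂ, ¬ (superM₂ m α).Iso (superM₃ m)) ∧
    (∀ (α : ℂ) (b : Fin ((m - 1) / 2) → ℂ), ¬ (superM₂ m α).Iso (superM₄ m b)) ∧
    (∀ b : Fin ((m - 1) / 2) → ℂ, ¬ (superM₃ m).Iso (superM₄ m b)) ∧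
    -- isomorphisms inside the two families with parameters
    (∀ α β : ℂ, (superM₂ m α).Iso (superM₂ m β) → α = β) ∧
    (∀ b b' : Fin ((m - 1) / 2) → ℂ, (superM₄ m b).Iso (superM₄ m b') ↔
      ∃ r : ℂ, r ≠ 0 ∧ ∀ k : Fin ((m - 1) / 2), (k : ℕ) ≠ 0 →
        b' k = r ^ (2 * (k : ℕ) + 1) * b k) ∧
    -- the first nonzero parameter of the last family can be reduced to `1`
    (∀ (b : Fin ((m - 1) / 2) → ℂ) (k : Fin ((m - 1) / 2)), (∀ j < k, b j = 0) → b k ≠ 0 →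
      ∃ b' : Fin ((m - 1) / 2) → ℂ, (∀ j < k, b' j = 0) ∧ b' k = 1 ∧
        (superM₄ m b).Iso (superM₄ m b')) := by
  obtain ⟨F₁⟩ := superM₁_frame m
  obtain ⟨F₃⟩ := superM₃_frame m
  refine ⟨fun S hS => superM_classification hodd hm hS,
    isSolvableExtension_of_weightMap F₁ hodd hm (mul_zero _), fun α => ?_,
    isSolvableExtension_of_weightMap F₃ hodd hm (zero_mul _), superM₄_isSolvableExtension hodd,
    fun α h => ?_, fun h => ?_, not_iso_superM₄ (by omega) F₁, fun α h => ?_, fun α => ?_,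
    not_iso_superM₄ (by omega) F₃, fun α β h => ?_, fun b b' => ?_, fun b k hb hk => ?_⟩
  · obtain ⟨F₂⟩ := superM₂_frame m α
    exact isSolvableExtension_of_weightMap F₂ hodd hm (zero_mul _)
  · obtain ⟨F₂⟩ := superM₂_frame m α
    -- `θ` changes only by a nonzero factor, so `1` cannot become `0`.
    obtain ⟨-, p, q, r, -, hr, -, h2⟩ := iso_weightMap hm F₁ F₂ h
    exact hr (by simpa using h2.symm)
  · exact zero_ne_one (iso_weightMap hm F₁ F₃ h).1
  · obtain ⟨F₂⟩ := superM₂_frame m α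
    -- Equality of `d` forces `α = 1`; then `q` cancels from the relation for `b`, leaving `p = 0`.
    obtain ⟨rfl, p, q, r, hp, -, h1, -⟩ := iso_weightMap hm F₂ F₃ h
    exact hp (by linear_combination h1)
  · obtain ⟨F₂⟩ := superM₂_frame m α
    exact not_iso_superM₄ (by omega) F₂
  · obtain ⟨F⟩ := superM₂_frame m α
    obtain ⟨G⟩ := superM₂_frame m β
    exact (iso_weightMap hm F G h).1
  · exact ⟨superM₄_params_of_iso (by omega), fun ⟨r, hr, h⟩ => superM₄_iso_of_params hm hr h⟩
  -- Index `k` stands for `b_{2(k+1)}`, which scales by `r ^ (2k + 1)`, so a root of `(b k)⁻¹`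
  -- normalises it.
  · obtain ⟨r, hr⟩ := IsAlgClosed.exists_pow_nat_eq (b k)⁻¹ (n := 2 * (k : ℕ) + 1) (by omega)
    have hr0 : r ≠ 0 := by
      rintro rfl
      rw [zero_pow (by omega)] at hr
      exact inv_ne_zero hk hr.symm
    exact ⟨fun j => r ^ (2 * (j : ℕ) + 1) * b j, fun j hj => by simp only [hb j hj, mul_zero],
      by simp only [hr, inv_mul_cancel₀ hk], superM₄_iso_of_params hm hr0 fun _ _ => rfl⟩
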